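/- Let $(M,\omega)$ be a connected symplectic $6$-manifold and let $\varphi$ be a smooth $3$-form on $M$ that is primitive, i.e. $\omega\wedge\varphi=0$. Define a field of endomorphisms $K=K(\varphi)$ of $TM$, a $3$-form $F(\varphi)$ and a function $Q(\varphi)$ on $M$ by $$\iota_{K(\varphi)v}\frac{\omega^3}{3!}=-\iota_v\varphi\wedge\varphi,\qquad F(\varphi)(v_1,v_2,v_3)=-2\,\varphi(K(\varphi)v_1,v_2,v_3),\qquad Q(\varphi)\frac{\omega^3}{3!}=-\varphi\wedge F(\varphi),$$ and let $N_K(X,Y)=-K^2[X,Y]+K([KX,Y]+[X,KY])-[KX,KY]$ for smooth vector fields $X,Y$ on $M$. A $3$-form on a $6$-dimensional real vector space $V$ is called stable if its orbit under $\mathrm{GL}(V)$ is open in $\bigwedge^3V^*$, and unstable otherwise. If $\varphi$ is integrable ($\mathrm d\varphi=0$) and $F$-integrable ($\mathrm dF(\varphi)=0$), then it is $K$-integrable ($N_K(X,Y)=0$ for all smooth vector fields $X,Y$) and $Q$-integrable ($Q(\varphi)$ is a constant function on $M$). Moreover, either $\varphi$ is stable at every point of $M$ or $\varphi$ is unstable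 at every point of $M$. -/

import Mathlib

open scoped Manifold

namespace ThreeForm
noncomputable section

/-- The exterior product of two alternating forms, in the shuffle normalization
`(a ∧ b)(v₁, …, vₙ) = ∑ sign σ · a(v_σ(1), …) · b(v_σ(p+1), …)`, the sum over `(p, q)`-shuffles. -/
def wedge {V : Type*} [AddCommGroup V] [Module ℝ V] {p q n : ℕ} (h : p + q = n)
    (a : V [⋀^Fin p]→ₗ[ℝ] ℝ) (b : V [⋀^Fin q]→ₗ[ℝ] ℝ) : V [⋀^Fin n]→ₗ[ℝ] ℝ :=
  ((LinearMap.mul' ℝ ℝ).compAlternatingMap (a.domCoprod b)).domDomCongr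
    (finSumFinEquiv.trans (finCongr h))

/-- Representatives of the ten `(2, 3)`-shuffles. -/
def sh : Fin 10 → Equiv.Perm (Fin 2 ⊕ Fin 3) :=
  ![1, Equiv.swap (.inl 1) (.inr 0), Equiv.swap (.inl 1) (.inr 1), Equiv.swap (.inl 1) (.inr 2),
    Equiv.swap (.inl 0) (.inr 0), Equiv.swap (.inl 0) (.inr 1), Equiv.swap (.inl 0) (.inr 2),
    Equiv.swap (.inl 0) (.inr 0) * Equiv.swap (.inl 1) (.inr 1),
    Equiv.swap (.inl 0) (.inr 0) * Equiv.swap (.inl 1) (.inr 2),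
    Equiv.swap (.inl 0) (.inr 1) * Equiv.swap (.inl 1) (.inr 2)]

theorem sh_bij : Function.Bijective
    (fun t => (Quotient.mk'' (sh t) : Equiv.Perm.ModSumCongr (Fin 2) (Fin 3))) := by
  rw [Fintype.bijective_iff_injective_and_card]
  constructor
  · have key : ∀ s t : Fin 10, s ≠ t →
        ¬ (∀ i : Fin 2, (((sh s)⁻¹ * sh t) (Sum.inl i)).isLeft = true) := by decide
    intro s t hst
    by_contra hne
    apply key s t hne
    have h := QuotientGroup.leftRel_apply.mp (Quotient.exact hst)
    obtain ⟨⟨x, y⟩, h⟩ := h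
    intro i
    rw [← h]
    rfl
  · have h := Subgroup.card_eq_card_quotient_mul_card_subgroup
      (Equiv.Perm.sumCongrHom (Fin 2) (Fin 3)).range
    have h2 : Nat.card (Equiv.Perm.sumCongrHom (Fin 2) (Fin 3)).range = 12 := by
      rw [← Nat.card_congr (MonoidHom.ofInjective Equiv.Perm.sumCongrHom_injective).toEquiv]
      simp [Nat.card_eq_fintype_card, Fintype.card_perm, Nat.factorial]
    rw [h2, Nat.card_eq_fintype_card, Nat.card_eq_fintype_card, Fintype.card_perm] at h
    simp [Nat.factorial] at h
    have h3 : Fintype.card (Equiv.Perm.ModSumCongr (Fin 2) (Fin 3)) =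
      Fintype.card ((Equiv.Perm (Fin 2 ⊕ Fin 3)) ⧸ (Equiv.Perm.sumCongrHom (Fin 2) (Fin 3)).range) :=
        Fintype.card_congr (Equiv.refl _)
    have h4 : 10 = Fintype.card (Equiv.Perm.ModSumCongr (Fin 2) (Fin 3)) := by omega
    exact (Fintype.card_fin 10).trans h4

theorem wedge_apply {V : Type*} [AddCommGroup V] [Module ℝ V] {p q n : ℕ} (h : p + q = n)
    (a : V [⋀^Fin p]→ₗ[ℝ] ℝ) (b : V [⋀^Fin q]→ₗ[ℝ] ℝ) (w : Fin n → V) :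
    wedge h a b w =
      LinearMap.mul' ℝ ℝ (a.domCoprod b fun i => w (finCongr h (finSumFinEquiv i))) := rfl

/-- The exterior product with a fixed right factor, as a linear map. -/
def wedgeLeft {V : Type*} [AddCommGroup V] [Module ℝ V] {p q n : ℕ} (h : p + q = n)
    (b : V [⋀^Fin q]→ₗ[ℝ] ℝ) : (V [⋀^Fin p]→ₗ[ℝ] ℝ) →ₗ[ℝ] (V [⋀^Fin n]→ₗ[ℝ] ℝ) where
  toFun a := wedge h a b
  map_add' a a' := by
    ext w
    rw [AlternatingMap.add_apply, wedge_apply, wedge_apply, wedge_apply, ← map_add]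
    congr 1
    simp only [← AlternatingMap.domCoprod'_apply, TensorProduct.add_tmul, map_add,
      AlternatingMap.add_apply]
  map_smul' c a := by
    ext w
    rw [RingHom.id_apply, AlternatingMap.smul_apply, wedge_apply, wedge_apply, ← map_smul]
    congr 1
    simp only [← AlternatingMap.domCoprod'_apply, ← TensorProduct.smul_tmul', map_smul,
      AlternatingMap.smul_apply]

theorem wedgeLeft_apply {V : Type*} [AddCommGroup V] [Module ℝ V] {p q n : ℕ} (h : p + q = n)
    (a : V [⋀^Fin p]→ₗ[ℝ] ℝ) (b : V [⋀^Fin q]→ₗ[ℝ] ℝ) : wedgeLeft h b a = wedge h a b := rfl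

theorem sum_alternating_apply {V : Type*} [AddCommGroup V] [Module ℝ V] {n m : ℕ}
    (g : Fin m → V [⋀^Fin n]→ₗ[ℝ] ℝ) (w : Fin n → V) : (∑ i, g i) w = ∑ i, g i w :=
  map_sum (AddMonoidHom.mk' (fun a : V [⋀^Fin n]→ₗ[ℝ] ℝ => a w) fun _ _ => rfl) g Finset.univ

theorem wedge_two_three {V : Type*} [AddCommGroup V] [Module ℝ V]
    (a : V [⋀^Fin 2]→ₗ[ℝ] ℝ) (b : V [⋀^Fin 3]→ₗ[ℝ] ℝ) (w : Fin 5 → V) :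
    wedge rfl a b w = a ![w 0, w 1] * b ![w 2, w 3, w 4]
      - a ![w 0, w 2] * b ![w 1, w 3, w 4]
      - a ![w 0, w 3] * b ![w 2, w 1, w 4]
      - a ![w 0, w 4] * b ![w 2, w 3, w 1]
      - a ![w 2, w 1] * b ![w 0, w 3, w 4]
      - a ![w 3, w 1] * b ![w 2, w 0, w 4]
      - a ![w 4, w 1] * b ![w 2, w 3, w 0]
      + a ![w 2, w 3] * b ![w 0, w 1, w 4]
      + a ![w 2, w 4] * b ![w 0, w 3, w 1]
      + a ![w 3, w 4] * b ![w 2, w 0, w 1] := by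
  have hs : ∀ t, Equiv.Perm.sign (sh t) = ![1,-1,-1,-1,-1,-1,-1,1,1,1] t := by decide
  have hv : ∀ t, LinearMap.mul' ℝ ℝ (AlternatingMap.domCoprod.summand a b (Quotient.mk'' (sh t))
      (fun i => w (finSumFinEquiv i))) = ((![1,-1,-1,-1,-1,-1,-1,1,1,1] t : ℤˣ) : ℤ) *
        (a ![w (finSumFinEquiv (sh t (.inl 0))), w (finSumFinEquiv (sh t (.inl 1)))] *
         b ![w (finSumFinEquiv (sh t (.inr 0))), w (finSumFinEquiv (sh t (.inr 1))),
          w (finSumFinEquiv (sh t (.inr 2)))]) := by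
    intro t
    rw [AlternatingMap.domCoprod.summand_mk'', hs]
    have e2 : ∀ u : Fin 2 → V, a u = a ![u 0, u 1] := fun u => by
      congr 1; ext i; fin_cases i <;> rfl
    have e3 : ∀ u : Fin 3 → V, b u = b ![u 0, u 1, u 2] := fun u => by
      congr 1; ext i; fin_cases i <;> rfl
    rw [Units.smul_def, _root_.smul_apply, map_zsmul, zsmul_eq_mul,
      MultilinearMap.domDomCongr_apply, MultilinearMap.domCoprod_apply, LinearMap.mul'_apply,
      AlternatingMap.coe_multilinearMap, AlternatingMap.coe_multilinearMap, e2, e3]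
  have hsum : wedge rfl a b w = ∑ t : Fin 10, LinearMap.mul' ℝ ℝ
      (AlternatingMap.domCoprod.summand a b (Quotient.mk'' (sh t))
        fun i => w (finSumFinEquiv i)) := by
    have h := Equiv.sum_comp (Equiv.ofBijective _ sh_bij)
      (fun q => AlternatingMap.domCoprod.summand a b q fun i => w (finSumFinEquiv i))
    simp only [Equiv.ofBijective_apply] at h
    rw [← map_sum, h, wedge_apply, AlternatingMap.domCoprod_apply, _root_.sum_apply]
    rfl
  rw [hsum]
  simp only [hv, Fin.sum_univ_succ]
  simp [sh, Equiv.swap_apply_def]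
  rw [show finSumFinEquiv (Sum.inl 0 : Fin 2 ⊕ Fin 3) = 0 from rfl,
    show finSumFinEquiv (Sum.inl 1 : Fin 2 ⊕ Fin 3) = 1 from rfl,
    show finSumFinEquiv (Sum.inr 0 : Fin 2 ⊕ Fin 3) = 2 from rfl,
    show finSumFinEquiv (Sum.inr 1 : Fin 2 ⊕ Fin 3) = 3 from rfl,
    show finSumFinEquiv (Sum.inr 2 : Fin 2 ⊕ Fin 3) = 4 from rfl]
  ring


section DualVector
variable {V : Type*} [AddCommGroup V] [Module ℝ V]

/-- For a 6-form `τ ≠ 0` on a 6-dimensional space, the inverse of the isomorphism `v ↦ ι_v τ` from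
vectors to 5-forms, written in a basis `b`; see `curryLeft_dualVector` and `dualVector_curryLeft`,
and `dualVector_eq` for the independence of the basis. (`ι_v` is `AlternatingMap.curryLeft`.) -/
def dualVector (b : Module.Basis (Fin 6) ℝ V) (τ : V [⋀^Fin 6]→ₗ[ℝ] ℝ) :
    (V [⋀^Fin 5]→ₗ[ℝ] ℝ) →ₗ[ℝ] V where
  toFun θ := ∑ i : Fin 6, ((-1) ^ (i : ℕ) * θ (fun j => b (i.succAbove j)) / τ b) • b i
  map_add' θ θ' := by
    simp only [AlternatingMap.add_apply, mul_add, add_div, add_smul, Finset.sum_add_distrib]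
  map_smul' c θ := by
    simp only [AlternatingMap.smul_apply, Finset.smul_sum, smul_smul, RingHom.id_apply, smul_eq_mul]
    refine Finset.sum_congr rfl fun i _ => ?_
    congr 1
    ring

theorem dualVector_apply (b : Module.Basis (Fin 6) ℝ V) (τ : V [⋀^Fin 6]→ₗ[ℝ] ℝ)
    (θ : V [⋀^Fin 5]→ₗ[ℝ] ℝ) :
    dualVector b τ θ =
      ∑ i : Fin 6, ((-1) ^ (i : ℕ) * θ (fun j => b (i.succAbove j)) / τ b) • b i := rfl

theorem apply_basis_ne_zero (b : Module.Basis (Fin 6) ℝ V) (τ : V [⋀^Fin 6]→ₗ[ℝ] ℝ) (hτ : τ ≠ 0) :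
    τ b ≠ 0 := by
  intro h
  apply hτ
  rw [τ.eq_smul_basis_det b, h, zero_smul]

theorem vecCons_succAbove (b : Module.Basis (Fin 6) ℝ V) (τ : V [⋀^Fin 6]→ₗ[ℝ] ℝ) (i k : Fin 6) :
    τ (Matrix.vecCons (b i) fun j => b (k.succAbove j)) =
      if i = k then (-1) ^ (k : ℕ) * τ b else 0 := by
  split_ifs with hik
  · subst hik
    rw [← AlternatingMap.neg_one_pow_smul_map_insertNth τ i]
    have h2 : (i.insertNth (b i) fun j => b (i.succAbove j)) = ⇑b :=
      Fin.insertNth_self_removeNth i b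
    rw [h2]
    simp
  · obtain ⟨j, hj⟩ := Fin.exists_succAbove_eq hik
    refine τ.map_eq_zero_of_eq _ (i := 0) (j := j.succ) ?_ (Fin.succ_ne_zero j).symm
    simp only [Matrix.cons_val_zero, Matrix.cons_val_succ, hj]

theorem dualVector_curryLeft (b : Module.Basis (Fin 6) ℝ V) (τ : V [⋀^Fin 6]→ₗ[ℝ] ℝ) (hτ : τ ≠ 0)
    (w : V) : dualVector b τ (τ.curryLeft w) = w := by
  have h0 := apply_basis_ne_zero b τ hτ
  suffices h : dualVector b τ ∘ₗ τ.curryLeft = LinearMap.id from LinearMap.congr_fun h w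
  refine b.ext fun k => ?_
  rw [LinearMap.comp_apply, dualVector_apply, LinearMap.id_apply, Finset.sum_eq_single k]
  · rw [AlternatingMap.curryLeft_apply_apply, vecCons_succAbove, if_pos rfl, ← mul_assoc,
      ← mul_pow, mul_div_assoc, div_self h0]
    norm_num
  · intro i _ hik
    rw [AlternatingMap.curryLeft_apply_apply, vecCons_succAbove, if_neg hik.symm, mul_zero,
      zero_div, zero_smul]
  · exact fun h => absurd (Finset.mem_univ k) h

theorem curryLeft_dualVector (b : Module.Basis (Fin 6) ℝ V) (τ : V [⋀^Fin 6]→ₗ[ℝ] ℝ) (hτ : τ ≠ 0)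
    (θ : V [⋀^Fin 5]→ₗ[ℝ] ℝ) : τ.curryLeft (dualVector b τ θ) = θ := by
  have h0 := apply_basis_ne_zero b τ hτ
  refine Module.Basis.ext_alternating b fun v hv => ?_
  obtain ⟨k, hk⟩ : ∃ k, ∀ j, v j ≠ k := by
    by_contra! hcon
    have := Fintype.card_le_of_surjective v hcon
    simp at this
  obtain ⟨σ, hσ⟩ : ∃ σ : Equiv.Perm (Fin 5), ∀ j, v j = k.succAbove (σ j) := by
    choose f hf using fun j => Fin.exists_succAbove_eq (hk j)
    have hinj : Function.Injective f := fun a b hab => hv (by rw [← hf a, ← hf b, hab])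
    exact ⟨Equiv.ofBijective f (Finite.injective_iff_bijective.mp hinj), fun j => (hf j).symm⟩
  have hperm : ∀ η : V [⋀^Fin 5]→ₗ[ℝ] ℝ, η (fun j => b (v j)) =
      Equiv.Perm.sign σ • η (fun j => b (k.succAbove j)) := by
    intro η
    rw [← η.map_perm]
    congr 1
    ext1 j
    simp only [hσ, Function.comp_apply]
  rw [hperm, hperm]
  congr 1
  rw [dualVector_apply, map_sum]
  simp only [map_smul, sum_alternating_apply, AlternatingMap.smul_apply,
    AlternatingMap.curryLeft_apply_apply, vecCons_succAbove, smul_eq_mul, mul_ite, mul_zero,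
    Finset.sum_ite_eq', Finset.mem_univ, if_true]
  have hk2 : ((-1 : ℝ) ^ (k : ℕ)) * (-1) ^ (k : ℕ) = 1 := by
    rw [← mul_pow]; norm_num
  field_simp
  linear_combination θ (fun j => b (k.succAbove j)) * hk2

theorem dualVector_eq (b b' : Module.Basis (Fin 6) ℝ V) (τ : V [⋀^Fin 6]→ₗ[ℝ] ℝ) (hτ : τ ≠ 0) :
    dualVector b τ = dualVector b' τ := by
  ext θ
  rw [← dualVector_curryLeft b' τ hτ (dualVector b τ θ), curryLeft_dualVector b τ hτ]

theorem apply_dualVector_zero (b : Module.Basis (Fin 6) ℝ V) (τ : V [⋀^Fin 6]→ₗ[ℝ] ℝ)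
    (φ : V [⋀^Fin 3]→ₗ[ℝ] ℝ) :
    φ ![dualVector b τ (wedge (n := 5) rfl (φ.curryLeft (b 0)) φ), b 0, b 1] = 0 := by
  have hc : ∀ v, φ ![v, b 0, b 1] = φ.curryLeft v ![b 0, b 1] := fun v => rfl
  have e0 : (0 : Fin 6).succAbove = ![1, 2, 3, 4, 5] := by decide
  have e1 : (1 : Fin 6).succAbove = ![0, 2, 3, 4, 5] := by decide
  have e2 : (2 : Fin 6).succAbove = ![0, 1, 3, 4, 5] := by decide
  have e3 : (3 : Fin 6).succAbove = ![0, 1, 2, 4, 5] := by decide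
  have e4 : (4 : Fin 6).succAbove = ![0, 1, 2, 3, 5] := by decide
  have e5 : (5 : Fin 6).succAbove = ![0, 1, 2, 3, 4] := by decide
  have p : ((2 : Fin 6) : ℕ) = 2 ∧ ((3 : Fin 6) : ℕ) = 3 ∧ ((4 : Fin 6) : ℕ) = 4 ∧
      ((5 : Fin 6) : ℕ) = 5 := by decide
  obtain ⟨f, hf⟩ : ∃ f : Fin 6 → Fin 6 → Fin 6 → ℝ, ∀ i j k, φ ![b i, b j, b k] = f i j k :=
    ⟨_, fun _ _ _ => rfl⟩
  have h12 : ∀ i j k, f j i k = - f i j k := fun i j k => by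
    rw [← hf, ← hf, ← φ.map_swap ![b i, b j, b k] (show (0 : Fin 3) ≠ 1 by decide)]
    congr 1
    ext1 m
    fin_cases m <;> rfl
  have h23 : ∀ i j k, f i k j = - f i j k := fun i j k => by
    rw [← hf, ← hf, ← φ.map_swap ![b i, b j, b k] (show (1 : Fin 3) ≠ 2 by decide)]
    congr 1
    ext1 m
    fin_cases m <;> rfl
  have d12 : ∀ i k, f i i k = 0 := fun i k => by linarith [h12 i i k]
  have d23 : ∀ i k, f i k k = 0 := fun i k => by linarith [h23 i k k]
  have hW : ∀ w : Fin 5 → Fin 6,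
      wedge (n := 5) rfl (φ.curryLeft (b 0)) φ (fun j => b (w j)) =
      f 0 (w 0) (w 1) * f (w 2) (w 3) (w 4) - f 0 (w 0) (w 2) * f (w 1) (w 3) (w 4)
      - f 0 (w 0) (w 3) * f (w 2) (w 1) (w 4) - f 0 (w 0) (w 4) * f (w 2) (w 3) (w 1)
      - f 0 (w 2) (w 1) * f (w 0) (w 3) (w 4) - f 0 (w 3) (w 1) * f (w 2) (w 0) (w 4)
      - f 0 (w 4) (w 1) * f (w 2) (w 3) (w 0) + f 0 (w 2) (w 3) * f (w 0) (w 1) (w 4)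
      + f 0 (w 2) (w 4) * f (w 0) (w 3) (w 1) + f 0 (w 3) (w 4) * f (w 2) (w 0) (w 1) := by
    intro w
    rw [wedge_two_three]
    simp only [AlternatingMap.curryLeft_apply_apply, hf]
  rw [hc, dualVector_apply, map_sum, sum_alternating_apply]
  simp only [map_smul, AlternatingMap.smul_apply,
    AlternatingMap.curryLeft_apply_apply, hf, hW, Fin.sum_univ_six, e0, e1, e2, e3, e4, e5,
    p.1, p.2.1, p.2.2.1, p.2.2.2, Fin.val_zero, Fin.val_one, smul_eq_mul]
  simp only [Matrix.cons_val, Fin.isValue, d12, d23, h12 0 1, h12 0 2, h12 0 3, h12 0 4, h12 0 5,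
    h12 1 2, h12 1 3, fun i => h23 i 0 3, fun i => h23 i 0 4, fun i => h23 i 1 2,
    fun i => h23 i 1 3, fun i => h23 i 1 4, fun i => h23 i 1 5, fun i => h23 i 2 3,
    fun i => h23 i 2 4, fun i => h23 i 2 5, h12 2 3]
  ring

/-- The volume form `ω³ / 3!` of a 2-form `ω`. -/
def liouville (ω : V [⋀^Fin 2]→ₗ[ℝ] ℝ) : V [⋀^Fin 6]→ₗ[ℝ] ℝ :=
  (1 / 6 : ℝ) • wedge (n := 6) rfl (wedge (n := 4) rfl ω ω) ω

/-- The endomorphism `K(φ)`, with `⋀⁶V*` trivialized by `ω³/3!`: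
`ι_{K(φ)v} (ω³/3!) = -ι_v φ ∧ φ`; see `curryLeft_K`. It does not depend on the basis `b`. -/
def K (b : Module.Basis (Fin 6) ℝ V) (ω : V [⋀^Fin 2]→ₗ[ℝ] ℝ) (φ : V [⋀^Fin 3]→ₗ[ℝ] ℝ) : V →ₗ[ℝ] V :=
  -(dualVector b (liouville ω) ∘ₗ wedgeLeft (n := 5) rfl φ ∘ₗ φ.curryLeft)

theorem K_apply (b : Module.Basis (Fin 6) ℝ V) (ω : V [⋀^Fin 2]→ₗ[ℝ] ℝ) (φ : V [⋀^Fin 3]→ₗ[ℝ] ℝ) (v : V) :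
    K b ω φ v = -dualVector b (liouville ω) (wedge (n := 5) rfl (φ.curryLeft v) φ) := by
  rw [K, LinearMap.neg_apply, LinearMap.comp_apply, LinearMap.comp_apply, wedgeLeft_apply]

/-- The identity `φ(K(φ) v, v, u) = 0`, by which `F(φ)` is alternating. -/
theorem apply_K_self (b : Module.Basis (Fin 6) ℝ V) (ω : V [⋀^Fin 2]→ₗ[ℝ] ℝ) (φ : V [⋀^Fin 3]→ₗ[ℝ] ℝ) (v u : V) :
    φ ![K b ω φ v, v, u] = 0 := by
  have hK : ∀ w, φ ![K b ω φ v, v, w] =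
      -φ ![dualVector b (liouville ω) (wedge (n := 5) rfl (φ.curryLeft v) φ), v, w] := by
    intro w
    have hc : ∀ x, φ ![x, v, w] = φ.curryLeft x ![v, w] := fun x => rfl
    rw [hc, hc, K_apply, map_neg, AlternatingMap.neg_apply]
  by_cases hτ : liouville ω = 0
  · rw [hK, hτ, dualVector_apply]
    simp only [AlternatingMap.zero_apply, div_zero, zero_smul, Finset.sum_const_zero]
    rw [φ.map_coord_zero (0 : Fin 3) rfl, neg_zero]
  by_cases hv : LinearIndependent ℝ ![v, u]
  · have := Module.Finite.of_basis b
    have hr : Module.finrank ℝ V = 6 := by simp [Module.finrank_eq_card_basis b]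
    obtain ⟨x1, h1⟩ := exists_linearIndependent_snoc_of_lt_finrank hv (by rw [hr]; norm_num)
    obtain ⟨x2, h2⟩ := exists_linearIndependent_snoc_of_lt_finrank h1 (by rw [hr]; norm_num)
    obtain ⟨x3, h3⟩ := exists_linearIndependent_snoc_of_lt_finrank h2 (by rw [hr]; norm_num)
    obtain ⟨x4, h4⟩ := exists_linearIndependent_snoc_of_lt_finrank h3 (by rw [hr]; norm_num)
    let b' : Module.Basis (Fin 6) ℝ V :=
      basisOfLinearIndependentOfCardEqFinrank h4 (by rw [hr]; simp)
    have hb0 : b' 0 = v := by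
      rw [coe_basisOfLinearIndependentOfCardEqFinrank]
      rfl
    have hb1 : b' 1 = u := by
      rw [coe_basisOfLinearIndependentOfCardEqFinrank]
      rfl
    rw [hK, dualVector_eq b b' _ hτ, ← hb0, ← hb1, apply_dualVector_zero, neg_zero]
  · by_cases hv0 : v = 0
    · exact φ.map_coord_zero (1 : Fin 3) (by simp [hv0])
    · obtain ⟨c, hc⟩ : ∃ c : ℝ, u = c • v := by
        by_contra! hcon
        exact hv ((LinearIndependent.pair_iff' hv0).mpr fun a ha => hcon a ha.symm)
      have hd : ∀ w, φ ![K b ω φ v, v, w] = (φ.curryLeft (K b ω φ v)).curryLeft v ![w] :=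
        fun w => rfl
      have hz : φ ![K b ω φ v, v, v] = 0 :=
        φ.map_eq_zero_of_eq _ (i := 1) (j := 2) rfl (by decide)
      have hs := ((φ.curryLeft (K b ω φ v)).curryLeft v).map_update_smul ![u] 0 c v
      have hu : ∀ w : V, Function.update ![u] 0 w = ![w] := fun w => by
        ext1 m
        fin_cases m
        rfl
      rw [hu, hu] at hs
      rw [hc, hd, hs, ← hd, hz, smul_zero]

/-- The multilinear map `(v₀, v₁, …) ↦ φ(A v₀, v₁, …)`. -/
def contractFirst {n : ℕ} (A : V →ₗ[ℝ] V) (φ : V [⋀^Fin (n + 1)]→ₗ[ℝ] ℝ) :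
    MultilinearMap ℝ (fun _ : Fin (n + 1) => V) ℝ :=
  LinearMap.uncurryLeft (AlternatingMap.toMultilinearMapLM (S := ℝ) ∘ₗ φ.curryLeft ∘ₗ A)

theorem contractFirst_apply {n : ℕ} (A : V →ₗ[ℝ] V) (φ : V [⋀^Fin (n + 1)]→ₗ[ℝ] ℝ)
    (v : Fin (n + 1) → V) :
    contractFirst A φ v = φ (Matrix.vecCons (A (v 0)) (Fin.tail v)) := rfl

theorem contractFirst_apply_three (A : V →ₗ[ℝ] V) (φ : V [⋀^Fin 3]→ₗ[ℝ] ℝ) (v : Fin 3 → V) :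
    contractFirst A φ v = φ ![A (v 0), v 1, v 2] := by
  rw [contractFirst_apply]
  congr 1
  ext1 m
  fin_cases m <;> rfl

/-- The 3-form `(v₀, v₁, v₂) ↦ φ(K(φ) v₀, v₁, v₂)`; that it is alternating follows from
`apply_K_self`. -/
def contractK (b : Module.Basis (Fin 6) ℝ V) (ω : V [⋀^Fin 2]→ₗ[ℝ] ℝ)
    (φ : V [⋀^Fin 3]→ₗ[ℝ] ℝ) : V [⋀^Fin 3]→ₗ[ℝ] ℝ :=
  AlternatingMap.mk (contractFirst (n := 2) (K b ω φ) φ) <| by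
      intro v i j hij hne
      suffices h : φ ![K b ω φ (v 0), v 1, v 2] = 0 from
        (contractFirst_apply_three (K b ω φ) φ v).trans h
      have h01 : v 0 = v 1 → φ ![K b ω φ (v 0), v 1, v 2] = 0 := fun h => by
        rw [← h]
        exact apply_K_self b ω φ _ _
      have h12 : v 1 = v 2 → φ ![K b ω φ (v 0), v 1, v 2] = 0 := fun h =>
        φ.map_eq_zero_of_eq _ (i := 1) (j := 2) h (by decide)
      have h02 : v 0 = v 2 → φ ![K b ω φ (v 0), v 1, v 2] = 0 := fun h => by
        have hs := φ.map_swap ![K b ω φ (v 0), v 0, v 1] (show (1 : Fin 3) ≠ 2 by decide)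
        rw [apply_K_self b ω φ _ _, neg_zero] at hs
        rw [← hs, ← h]
        congr 1
        ext1 m
        fin_cases m <;> rfl
      fin_cases i <;> fin_cases j <;> first
        | exact absurd rfl hne
        | exact h01 hij
        | exact h12 hij
        | exact h02 hij
        | exact h01 hij.symm
        | exact h12 hij.symm
        | exact h02 hij.symm

theorem contractK_apply (b : Module.Basis (Fin 6) ℝ V) (ω : V [⋀^Fin 2]→ₗ[ℝ] ℝ)
    (φ : V [⋀^Fin 3]→ₗ[ℝ] ℝ) (v : Fin 3 → V) :
    contractK b ω φ v = φ ![K b ω φ (v 0), v 1, v 2] := by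
  exact contractFirst_apply_three (K b ω φ) φ v

/-- The 3-form `F(φ)(v₀, v₁, v₂) = -2 φ(K(φ) v₀, v₁, v₂)`; see `F_apply`. -/
def F (b : Module.Basis (Fin 6) ℝ V) (ω : V [⋀^Fin 2]→ₗ[ℝ] ℝ)
    (φ : V [⋀^Fin 3]→ₗ[ℝ] ℝ) : V [⋀^Fin 3]→ₗ[ℝ] ℝ :=
  (-2 : ℝ) • contractK b ω φ

theorem F_apply (b : Module.Basis (Fin 6) ℝ V) (ω : V [⋀^Fin 2]→ₗ[ℝ] ℝ)
    (φ : V [⋀^Fin 3]→ₗ[ℝ] ℝ) (v : Fin 3 → V) :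
    F b ω φ v = -2 * φ ![K b ω φ (v 0), v 1, v 2] := by
  rw [F, AlternatingMap.smul_apply, contractK_apply, smul_eq_mul]

theorem K_eq (b b' : Module.Basis (Fin 6) ℝ V) (ω : V [⋀^Fin 2]→ₗ[ℝ] ℝ)
    (φ : V [⋀^Fin 3]→ₗ[ℝ] ℝ) (h : liouville ω ≠ 0) : K b ω φ = K b' ω φ := by
  rw [K, K, dualVector_eq b b' _ h]

theorem curryLeft_K (b : Module.Basis (Fin 6) ℝ V) (ω : V [⋀^Fin 2]→ₗ[ℝ] ℝ) (φ : V [⋀^Fin 3]→ₗ[ℝ] ℝ)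
    (h : liouville ω ≠ 0) (v : V) :
    (liouville ω).curryLeft (K b ω φ v) = -wedge (n := 5) rfl (φ.curryLeft v) φ := by
  rw [K_apply, map_neg, curryLeft_dualVector _ _ h]

/-- The number `Q(φ)` with `Q(φ) ω³/3! = -φ ∧ F(φ)`; see `wedge_F`. -/
def Q (b : Module.Basis (Fin 6) ℝ V) (ω : V [⋀^Fin 2]→ₗ[ℝ] ℝ) (φ : V [⋀^Fin 3]→ₗ[ℝ] ℝ) : ℝ :=
  -(wedge (n := 6) rfl φ (F b ω φ) b) / liouville ω b

theorem wedge_F (b : Module.Basis (Fin 6) ℝ V) (ω : V [⋀^Fin 2]→ₗ[ℝ] ℝ) (φ : V [⋀^Fin 3]→ₗ[ℝ] ℝ)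
    (h : liouville ω ≠ 0) : wedge (n := 6) rfl φ (F b ω φ) = -(Q b ω φ • liouville ω) := by
  have h0 := apply_basis_ne_zero b _ h
  have hq : wedge (n := 6) rfl φ (F b ω φ) b = -Q b ω φ * liouville ω b := by
    rw [Q]
    field_simp
  rw [(wedge (n := 6) rfl φ (F b ω φ)).eq_smul_basis_det b, hq, mul_smul,
    ← (liouville ω).eq_smul_basis_det b, neg_smul]

end DualVector

/-! ### Differential forms on a 6-manifold -/

/-- The model space `ℝ⁶`; every tangent space `TangentSpace (𝓡 6) x` is a copy of it. -/
abbrev E6 : Type := EuclideanSpace ℝ (Fin 6)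

/-- The standard basis of `ℝ⁶`. -/
abbrev stdBasis : Module.Basis (Fin 6) ℝ E6 := (EuclideanSpace.basisFun (Fin 6) ℝ).toBasis

/-- A 3-form on `ℝ⁶` is stable if its orbit under the general linear group is open in the space of
all 3-forms. -/
def IsStable (φ : E6 [⋀^Fin 3]→L[ℝ] ℝ) : Prop :=
  IsOpen (Set.range fun g : E6 ≃L[ℝ] E6 => φ.compContinuousLinearMap (g : E6 →L[ℝ] E6))

theorem continuous_of_apply_eq (G : E6 [⋀^Fin 3]→ₗ[ℝ] ℝ) (φ : E6 [⋀^Fin 3]→L[ℝ] ℝ)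
    (A : E6 →ₗ[ℝ] E6) (h : ∀ v, G v = -2 * φ ![A (v 0), v 1, v 2]) : Continuous G := by
  rw [show ⇑G = fun v => -2 * φ ![A (v 0), v 1, v 2] from funext h]
  have hA : Continuous A := LinearMap.continuous_of_finiteDimensional A
  refine continuous_const.mul (φ.cont.comp (continuous_pi fun i => ?_))
  fin_cases i
  · exact hA.comp (continuous_apply 0)
  · exact continuous_apply 1
  · exact continuous_apply 2

/-- `F(φ)` as a continuous alternating map. -/
def continuousF (ω : E6 [⋀^Fin 2]→L[ℝ] ℝ) (φ : E6 [⋀^Fin 3]→L[ℝ] ℝ) : E6 [⋀^Fin 3]→L[ℝ] ℝ :=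
  let G := F stdBasis ω.toAlternatingMap φ.toAlternatingMap
  have hG : Continuous G := continuous_of_apply_eq _ φ _ (F_apply stdBasis _ φ.toAlternatingMap)
  ⟨⟨G.toMultilinearMap, hG⟩, fun v _ _ h hij => G.map_eq_zero_of_eq v h hij⟩

theorem continuousF_apply (ω : E6 [⋀^Fin 2]→L[ℝ] ℝ) (φ : E6 [⋀^Fin 3]→L[ℝ] ℝ)
    (v : Fin 3 → E6) : continuousF ω φ v =
      -2 * φ ![K stdBasis ω.toAlternatingMap φ.toAlternatingMap (v 0), v 1, v 2] :=
  F_apply _ _ _ v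

section Manifold
variable {M : Type*} [TopologicalSpace M] [ChartedSpace E6 M]

/-- A (not necessarily smooth) differential form of degree `k` on `M`. -/
abbrev DiffForm (M : Type*) [TopologicalSpace M] [ChartedSpace E6 M] (k : ℕ) : Type _ :=
  ∀ x : M, TangentSpace (𝓡 6) x [⋀^Fin k]→L[ℝ] ℝ

/-- The form `α` in the preferred chart at `x`: its pullback under the inverse of the chart. -/
def chartForm {k : ℕ} (α : DiffForm M k) (x : M) : E6 → E6 [⋀^Fin k]→L[ℝ] ℝ := fun y =>
  (α ((extChartAt (𝓡 6) x).symm y)).compContinuousLinearMap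
    (mfderiv 𝓘(ℝ, E6) (𝓡 6) (extChartAt (𝓡 6) x).symm y)

/-- A form is smooth if it is smooth in charts. -/
def IsSmoothForm {k : ℕ} (α : DiffForm M k) : Prop :=
  ∀ x : M, ContDiffOn ℝ ((⊤ : ℕ∞) : WithTop ℕ∞) (chartForm α x) (extChartAt (𝓡 6) x).target

/-- The exterior derivative `dα`: at `x` it is computed in the chart at `x` and pulled back. -/
def extDerivForm {k : ℕ} (α : DiffForm M k) : DiffForm M (k + 1) := fun x =>
  (extDeriv (chartForm α x) (extChartAt (𝓡 6) x x)).compContinuousLinearMap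
    (mfderiv (𝓡 6) 𝓘(ℝ, E6) (extChartAt (𝓡 6) x) x)

/-- `ω` is a symplectic form: smooth, closed and non-degenerate at every point. -/
structure IsSymplectic (ω : DiffForm M 2) : Prop where
  smooth : IsSmoothForm ω
  closed : ∀ x, extDerivForm ω x = 0
  nondegenerate : ∀ (x : M) (v : TangentSpace (𝓡 6) x),
    (∀ w : TangentSpace (𝓡 6) x, ω x ![v, w] = 0) → v = 0

/-- `φ` is `ω`-primitive: `ω ∧ φ = 0` at every point. -/
def IsPrimitive (ω : DiffForm M 2) (φ : DiffForm M 3) : Prop :=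
  ∀ x, wedge (n := 5) rfl (ω x).toAlternatingMap (φ x).toAlternatingMap = 0

/-- The section `K(φ)` of `End TM`. -/
def fieldK (ω : DiffForm M 2) (φ : DiffForm M 3) (x : M) :
    TangentSpace (𝓡 6) x →ₗ[ℝ] TangentSpace (𝓡 6) x :=
  K stdBasis (ω x).toAlternatingMap (φ x).toAlternatingMap

/-- The 3-form `F(φ)` on `M`. -/
def formF (ω : DiffForm M 2) (φ : DiffForm M 3) : DiffForm M 3 := fun x =>
  continuousF (ω x) (φ x)

/-- The function `Q(φ)` on `M`. -/
def functionQ (ω : DiffForm M 2) (φ : DiffForm M 3) (x : M) : ℝ :=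
  Q stdBasis (ω x).toAlternatingMap (φ x).toAlternatingMap

/-- A smooth vector field on `M`. -/
def IsSmoothField [IsManifold (𝓡 6) 1 M] (X : ∀ x : M, TangentSpace (𝓡 6) x) : Prop :=
  ContMDiff (𝓡 6) (𝓡 6).tangent ((⊤ : ℕ∞) : WithTop ℕ∞)
    fun x => (⟨x, X x⟩ : TangentBundle (𝓡 6) M)

/-- The Nijenhuis tensor
`N_A(X, Y) = -A²[X, Y] + A([AX, Y] + [X, AY]) - [AX, AY]` of a field `A` of endomorphisms. -/
def nijenhuis (A : ∀ x : M, TangentSpace (𝓡 6) x →ₗ[ℝ] TangentSpace (𝓡 6) x)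
    (X Y : ∀ x : M, TangentSpace (𝓡 6) x) (x : M) : TangentSpace (𝓡 6) x :=
  -A x (A x (VectorField.mlieBracket (𝓡 6) X Y x))
    + A x (VectorField.mlieBracket (𝓡 6) (fun y => A y (X y)) Y x
        + VectorField.mlieBracket (𝓡 6) X (fun y => A y (Y y)) x)
    - VectorField.mlieBracket (𝓡 6) (fun y => A y (X y)) (fun y => A y (Y y)) x

/-- `φ` is integrable: `dφ = 0`. -/
def IsIntegrable (φ : DiffForm M 3) : Prop := ∀ x, extDerivForm φ x = 0

/-- `φ` is `F`-integrable: `dF(φ) = 0`. -/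
def IsFIntegrable (ω : DiffForm M 2) (φ : DiffForm M 3) : Prop :=
  ∀ x, extDerivForm (formF ω φ) x = 0

/-- `φ` is `K`-integrable: the Nijenhuis tensor of `K(φ)` vanishes. -/
def IsKIntegrable [IsManifold (𝓡 6) 1 M] (ω : DiffForm M 2) (φ : DiffForm M 3) : Prop :=
  ∀ X Y : ∀ x : M, TangentSpace (𝓡 6) x, IsSmoothField X → IsSmoothField Y →
    ∀ x, nijenhuis (fieldK ω φ) X Y x = 0

/-- `φ` is `Q`-integrable: `Q(φ)` is a constant function. -/
def IsQIntegrable (ω : DiffForm M 2) (φ : DiffForm M 3) : Prop :=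
  ∃ c : ℝ, ∀ x, functionQ ω φ x = c

/-- `φ` is stable at the point `x`. -/
def IsStableAt (φ : DiffForm M 3) (x : M) : Prop := IsStable (φ x)

end Manifold
end
end ThreeForm

/-! Write τ = ω³/3!. In a basis b, K is 1/τ(b) times a matrix quadratic in the components of φ
(`polarK`, `repr_endo`), so pointwise facts about K become polynomial identities in those
components. They give tr K = 0, K² = c·1 and Q = (2/3) tr K² = 4c.

K-integrability: for any basis, the components along e₀ and e₂ of N(e₀, e₁) are linear combinations
of components of dφ and dF(φ), with coefficients built from φ, K and 1/τ(b) (`nijenhuisComp_zero`,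
`nijenhuisComp_two`). No sign of Q is assumed, so the complex, the product and the degenerate case
are treated together. If X, Y, N(X, Y) were independent, a basis with e₂ = N(X, Y) would contradict
the second identity; otherwise N(X, Y) lies in the span of X and Y, and the first identity, applied
also with X and Y exchanged, kills both coefficients (`nijenhuisTensor_eq_zero`).

Q-integrability: take the trace over X of N(X, Y) = 0. Two terms cancel by cyclicity, one vanishes
because tr K = 0, and what is left is tr(K ∘ D_Y K) = 0. Hence d tr K² = 0, and Q is constant on the
connected manifold M.

Stability: φ is stable at a point exactly when Q ≠ 0 there, so a constant Q gives the dichotomy. If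
Q ≠ 0, then K is invertible, and a polarized identity (`derivAction_endo`) shows that the
infinitesimal action of End(V) on φ reaches every 3-form, so the orbit is open. Conversely, the zero
set of Q is GL-invariant, and it is cut out by a nonzero quartic polynomial, so it contains no open
orbit. -/

namespace ThreeForm

/-! ### Polynomial identities in the components of a 3-form -/

/-- The array `f i j k` is alternating, as are the components of a 3-form in a basis. -/
structure IsAlt (f : Fin 6 → Fin 6 → Fin 6 → ℝ) : Prop where
  swap_left : ∀ i j k, f j i k = -f i j k
  swap_right : ∀ i j k, f i k j = -f i j k

namespace IsAlt
variable {f : Fin 6 → Fin 6 → Fin 6 → ℝ} (hf : IsAlt f)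
include hf

/-- The order hypothesis orients the swap towards increasing indices, so that it terminates as a
rewriting rule and brings every component to a normal form. -/
theorem sort_left (i j k : Fin 6) (_ : j < i) : f i j k = -f j i k := hf.swap_left j i k

theorem sort_right (i j k : Fin 6) (_ : k < j) : f i j k = -f i k j := hf.swap_right i k j

theorem diag_left (i k : Fin 6) : f i i k = 0 := by linarith [hf.swap_left i i k]

theorem diag_right (i k : Fin 6) : f i k k = 0 := by linarith [hf.swap_right i k k]

end IsAlt

/-- The component on `(w₀, …, w₄)` of `ι_v f ∧ g`. -/
def wedgeComp (f g : Fin 6 → Fin 6 → Fin 6 → ℝ) (v w₀ w₁ w₂ w₃ w₄ : Fin 6) : ℝ :=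
  f v w₀ w₁ * g w₂ w₃ w₄ - f v w₀ w₂ * g w₁ w₃ w₄ - f v w₀ w₃ * g w₂ w₁ w₄
    - f v w₀ w₄ * g w₂ w₃ w₁ - f v w₂ w₁ * g w₀ w₃ w₄ - f v w₃ w₁ * g w₂ w₀ w₄
    - f v w₄ w₁ * g w₂ w₃ w₀ + f v w₂ w₃ * g w₀ w₁ w₄ + f v w₂ w₄ * g w₀ w₃ w₁
    + f v w₃ w₄ * g w₂ w₀ w₁

/-- The matrix of the polarization of `K`, for the volume form with value `1` on the basis. -/
def polarK (f g : Fin 6 → Fin 6 → Fin 6 → ℝ) (i j : Fin 6) : ℝ :=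
  ![-wedgeComp f g j 1 2 3 4 5, wedgeComp f g j 0 2 3 4 5, -wedgeComp f g j 0 1 3 4 5,
    wedgeComp f g j 0 1 2 4 5, -wedgeComp f g j 0 1 2 3 5, wedgeComp f g j 0 1 2 3 4] i

/-- The components of the exterior derivative of a 3-form with partial derivatives `P`. -/
def alt4 (P : Fin 6 → Fin 6 → Fin 6 → Fin 6 → ℝ) (i j k l : Fin 6) : ℝ :=
  P i j k l - P j i k l + P k i j l - P l i j k

/-- The bivector dual to a 4-form. -/
def bivec (H : Fin 6 → Fin 6 → Fin 6 → Fin 6 → ℝ) (d e : Fin 6) : ℝ :=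
  ![![0, H 2 3 4 5, -H 1 3 4 5, H 1 2 4 5, -H 1 2 3 5, H 1 2 3 4],
    ![-H 2 3 4 5, 0, H 0 3 4 5, -H 0 2 4 5, H 0 2 3 5, -H 0 2 3 4],
    ![H 1 3 4 5, -H 0 3 4 5, 0, H 0 1 4 5, -H 0 1 3 5, H 0 1 3 4],
    ![-H 1 2 4 5, H 0 2 4 5, -H 0 1 4 5, 0, H 0 1 2 5, -H 0 1 2 4],
    ![H 1 2 3 5, -H 0 2 3 5, H 0 1 3 5, -H 0 1 2 5, 0, H 0 1 2 3],
    ![-H 1 2 3 4, H 0 2 3 4, -H 0 1 3 4, H 0 1 2 4, -H 0 1 2 3, 0]] d e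

set_option maxHeartbeats 4000000 in
/-- The component with upper index `2` of the Nijenhuis tensor of `s K` on the first two basis
vectors, in terms of the exterior derivatives of the 3-form and of its contraction with `s K`. -/
theorem nijenhuisComp_two (f : Fin 6 → Fin 6 → Fin 6 → ℝ) (hf : IsAlt f) (p : Fin 6 → Fin 6 → Fin 6 → Fin 6 → ℝ)
   (hp : ∀ u, IsAlt (p u)) (s : ℝ) (β : Fin 6 → ℝ)
    (k : Fin 6 → Fin 6 → ℝ) (D : Fin 6 → Fin 6 → Fin 6 → ℝ) (hk : ∀ i j, k i j = polarK f f i j)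
    (hD : ∀ u i j, D u i j = s * (polarK f (p u) i j + polarK (p u) f i j) + β u * polarK f f i j) :
    ∑ e, k 2 e * (D 0 e 1 - D 1 e 0) - ∑ u, (k u 0 * D u 2 1 - k u 1 * D u 2 0) =
     2 * ∑ d, f 0 1 d * bivec (alt4 fun u j l m => ∑ e, (D u e j * f e l m + s * k e j * p u e l m)) d 2
      - 2 * s * ∑ d, ∑ e, k 2 d * f 0 1 e * bivec (alt4 p) d e := by
  -- Once all components are sorted, both sides are polynomials in independent variables: the `f i j
  -- k` and `p u i j k` with i < j < k, together with s and β. The derivative β of the volume factor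
  -- stays arbitrary.
  have h1 := fun u => (hp u).sort_left
  have h2 := fun u => (hp u).sort_right
  have h3 := fun u => (hp u).diag_left
  have h4 := fun u => (hp u).diag_right
  simp only [hD, hk, Fin.sum_univ_six, bivec, alt4, polarK, wedgeComp, Matrix.cons_val, Fin.isValue,
    hf.diag_left, hf.diag_right, h3,
    mul_zero, zero_mul, add_zero, zero_add, sub_zero, zero_sub]
  simp only [hf.sort_left, hf.sort_right, h1, h2, Fin.reduceLT, Fin.isValue, hf.diag_left, hf.diag_right, h3, h4,
    mul_zero, zero_mul, add_zero, zero_add, sub_zero, zero_sub, neg_zero]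
  ring

set_option maxHeartbeats 4000000 in
/-- The component with upper index `0` of the Nijenhuis tensor of `s K` on the first two basis
vectors, in terms of the exterior derivatives of the 3-form and of its contraction with `s K`. -/
theorem nijenhuisComp_zero (f : Fin 6 → Fin 6 → Fin 6 → ℝ) (hf : IsAlt f) (p : Fin 6 → Fin 6 → Fin 6 → Fin 6 → ℝ)
   (hp : ∀ u, IsAlt (p u)) (s : ℝ) (β : Fin 6 → ℝ)
    (k : Fin 6 → Fin 6 → ℝ) (D : Fin 6 → Fin 6 → Fin 6 → ℝ) (hk : ∀ i j, k i j = polarK f f i j)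
    (hD : ∀ u i j, D u i j = s * (polarK f (p u) i j + polarK (p u) f i j) + β u * polarK f f i j) :
    ∑ e, k 0 e * (D 0 e 1 - D 1 e 0) - ∑ u, (k u 0 * D u 0 1 - k u 1 * D u 0 0) =
     2 * ∑ d, f 0 1 d * bivec (alt4 fun u j l m => ∑ e, (D u e j * f e l m + s * k e j * p u e l m)) d 0
      - ∑ d, ∑ e, f 1 d e * bivec (alt4 fun u j l m => ∑ e, (D u e j * f e l m + s * k e j * p u e l m)) d e
      - s * ∑ d, ∑ e, (∑ c, k c 1 * f c d e + 2 * k 0 d * f 0 1 e) * bivec (alt4 p) d e := by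
  have h1 := fun u => (hp u).sort_left
  have h2 := fun u => (hp u).sort_right
  have h3 := fun u => (hp u).diag_left
  have h4 := fun u => (hp u).diag_right
  simp only [hD, hk, Fin.sum_univ_six, bivec, alt4, polarK, wedgeComp, Matrix.cons_val, Fin.isValue,
    hf.diag_left, hf.diag_right, h3,
    mul_zero, zero_mul, add_zero, zero_add, sub_zero, zero_sub]
  simp only [hf.sort_left, hf.sort_right, h1, h2, Fin.reduceLT, Fin.isValue, hf.diag_left, hf.diag_right, h3, h4,
    mul_zero, zero_mul, add_zero, zero_add, sub_zero, zero_sub, neg_zero]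
  ring

/-- A single off-diagonal entry of K² is enough: since the basis is arbitrary, it forces K² to be
scalar, see `exists_endo_sq_eq_smul`. -/
theorem polarK_sq_offdiag {f : Fin 6 → Fin 6 → Fin 6 → ℝ} (hf : IsAlt f) :
    ∑ e, polarK f f 0 e * polarK f f e 1 = 0 := by
  simp only [Fin.sum_univ_six, polarK, wedgeComp, Matrix.cons_val, Fin.isValue,
    hf.diag_left, zero_mul, add_zero, sub_zero, zero_sub]
  simp only [hf.sort_left, hf.sort_right, Fin.reduceLT, Fin.isValue, hf.diag_left, hf.diag_right,
    zero_mul, add_zero, sub_zero, zero_sub, neg_zero]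
  ring

theorem polarK_trace {f : Fin 6 → Fin 6 → Fin 6 → ℝ} (hf : IsAlt f) :
    ∑ i, polarK f f i i = 0 := by
  simp only [Fin.sum_univ_six, polarK, wedgeComp, Matrix.cons_val, Fin.isValue,
    hf.diag_left, zero_mul, add_zero, sub_zero, zero_sub]
  simp only [hf.sort_left, hf.sort_right, Fin.reduceLT, Fin.isValue]
  ring

/-- The component of `f ∧ g` on the basis. -/
def pairing (f g : Fin 6 → Fin 6 → Fin 6 → ℝ) : ℝ :=
  f 0 1 2 * g 3 4 5 - f 0 1 3 * g 2 4 5 + f 0 1 4 * g 2 3 5 - f 0 1 5 * g 2 3 4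
    + f 0 2 3 * g 1 4 5 - f 0 2 4 * g 1 3 5 + f 0 2 5 * g 1 3 4 + f 0 3 4 * g 1 2 5
    - f 0 3 5 * g 1 2 4 + f 0 4 5 * g 1 2 3 - f 1 2 3 * g 0 4 5 + f 1 2 4 * g 0 3 5
    - f 1 2 5 * g 0 3 4 - f 1 3 4 * g 0 2 5 + f 1 3 5 * g 0 2 4 - f 1 4 5 * g 0 2 3
    + f 2 3 4 * g 0 1 5 - f 2 3 5 * g 0 1 4 + f 2 4 5 * g 0 1 3 - f 3 4 5 * g 0 1 2

/-- With L the derivative of K at f in the direction q, this is L·f = 2 K·q - 3 (f ∧ q) f for the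
derivation action on 3-forms, evaluated on the first three basis vectors. It puts K·q in the tangent
space of the orbit of f. -/
theorem polarK_derivation {f q : Fin 6 → Fin 6 → Fin 6 → ℝ} (hf : IsAlt f) (hq : IsAlt q) :
    ∑ e, ((polarK f q e 0 + polarK q f e 0) * f e 1 2 + (polarK f q e 1 + polarK q f e 1) * f 0 e 2
      + (polarK f q e 2 + polarK q f e 2) * f 0 1 e) =
    2 * ∑ e, (polarK f f e 0 * q e 1 2 + polarK f f e 1 * q 0 e 2 + polarK f f e 2 * q 0 1 e)
      - 3 * pairing f q * f 0 1 2 := by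
  simp only [Fin.sum_univ_six, polarK, wedgeComp, Matrix.cons_val, Fin.isValue, pairing,
    hf.diag_left, hf.diag_right, hq.diag_left, hq.diag_right,
    mul_zero, zero_mul, add_zero, zero_add, sub_zero, zero_sub]
  simp only [hf.sort_left, hf.sort_right, hq.sort_left, hq.sort_right, Fin.reduceLT, Fin.isValue,
    hf.diag_left, hf.diag_right, hq.diag_left, hq.diag_right,
    mul_zero, zero_mul, add_zero, zero_add, sub_zero, zero_sub, neg_zero]
  ring

/-- That is, φ ∧ (k·φ) = tr(kK) τ for every endomorphism k; the case where k is proportional to K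
turns Q into tr K². -/
theorem pairing_contract {f : Fin 6 → Fin 6 → Fin 6 → ℝ} (hf : IsAlt f) (k : Fin 6 → Fin 6 → ℝ) :
    pairing f (fun i j l => ∑ e, (k e i * f e j l + k e j * f i e l + k e l * f i j e)) =
      ∑ i, ∑ j, k i j * polarK f f j i := by
  simp only [Fin.sum_univ_six, polarK, wedgeComp, Matrix.cons_val, Fin.isValue, pairing,
    hf.diag_left, hf.diag_right,
    mul_zero, zero_mul, add_zero, zero_add, sub_zero, zero_sub]
  simp only [hf.sort_left, hf.sort_right, Fin.reduceLT, Fin.isValue, hf.diag_left, hf.diag_right,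
    mul_zero, zero_mul, add_zero, zero_add, sub_zero, zero_sub, neg_zero]
  ring

/-! ### Wedge products by shuffles, and nonvanishing of ω³ -/

section Wedge
variable {V V' : Type*} [AddCommGroup V] [Module ℝ V] [AddCommGroup V'] [Module ℝ V']

/-- The wedge product is a sum over cosets of S_p × S_q. By `hs` the listed permutations lie in
distinct cosets, and by `hN` there are as many of them as cosets, so they form a system of
representatives. -/
theorem wedge_eq_sum_shuffles {p q n N : ℕ} (h : p + q = n)
    (s : Fin N → Equiv.Perm (Fin p ⊕ Fin q))
    (hs : ∀ t t', t ≠ t' → ¬ ∀ i : Fin p, (((s t)⁻¹ * s t') (Sum.inl i)).isLeft = true)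
    (hN : (p + q).factorial = N * (p.factorial * q.factorial))
    (a : V [⋀^Fin p]→ₗ[ℝ] ℝ) (b : V [⋀^Fin q]→ₗ[ℝ] ℝ) (w : Fin n → V) :
    wedge h a b w = ∑ t, ((Equiv.Perm.sign (s t) : ℤ) : ℝ) *
      (a (fun i => w (finCongr h (finSumFinEquiv (s t (.inl i))))) *
        b (fun i => w (finCongr h (finSumFinEquiv (s t (.inr i)))))) := by
  have hbij : Function.Bijective
      (fun t => (Quotient.mk'' (s t) : Equiv.Perm.ModSumCongr (Fin p) (Fin q))) := by
    rw [Fintype.bijective_iff_injective_and_card]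
    constructor
    · intro t t' heq
      by_contra hne
      apply hs t t' hne
      obtain ⟨⟨x, y⟩, h⟩ := QuotientGroup.leftRel_apply.mp (Quotient.exact heq)
      intro i
      rw [← h]
      rfl
    · have h1 := Subgroup.card_eq_card_quotient_mul_card_subgroup
        (Equiv.Perm.sumCongrHom (Fin p) (Fin q)).range
      have h2 : Nat.card (Equiv.Perm.sumCongrHom (Fin p) (Fin q)).range =
          p.factorial * q.factorial := by
        rw [← Nat.card_congr
          (MonoidHom.ofInjective Equiv.Perm.sumCongrHom_injective).toEquiv]
        simp [Nat.card_eq_fintype_card, Fintype.card_perm]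
      rw [h2, Nat.card_eq_fintype_card, Nat.card_eq_fintype_card, Fintype.card_perm] at h1
      simp only [Fintype.card_sum, Fintype.card_fin, hN] at h1
      have h3 := Nat.eq_of_mul_eq_mul_right
        (Nat.mul_pos p.factorial_pos q.factorial_pos) h1
      exact (Fintype.card_fin N).trans (h3.trans (Fintype.card_congr (Equiv.refl _)))
  rw [wedge_apply, AlternatingMap.domCoprod_apply, _root_.sum_apply, map_sum]
  refine (Fintype.sum_bijective _ hbij _ _ fun t => ?_).symm
  rw [AlternatingMap.domCoprod.summand_mk'', Units.smul_def,
    _root_.smul_apply, map_zsmul, zsmul_eq_mul, MultilinearMap.domDomCongr_apply,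
    MultilinearMap.domCoprod_apply, LinearMap.mul'_apply]
  rfl

theorem wedge_compLinearMap {p q n : ℕ} (h : p + q = n) (a : V [⋀^Fin p]→ₗ[ℝ] ℝ)
    (b : V [⋀^Fin q]→ₗ[ℝ] ℝ) (g : V' →ₗ[ℝ] V) :
    wedge h (a.compLinearMap g) (b.compLinearMap g) = (wedge h a b).compLinearMap g := by
  ext w
  rw [AlternatingMap.compLinearMap_apply, wedge_apply, wedge_apply,
    AlternatingMap.domCoprod_apply, AlternatingMap.domCoprod_apply, _root_.sum_apply,
    _root_.sum_apply]
  congr 1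
  refine Finset.sum_congr rfl fun t _ => ?_
  induction t using Quotient.inductionOn' with
  | h t => rfl

theorem apply_vec_two (a : V [⋀^Fin 2]→ₗ[ℝ] ℝ) (u : Fin 2 → V) : a u = a ![u 0, u 1] := by
  congr 1; ext i; fin_cases i <;> rfl

theorem apply_vec_three (a : V [⋀^Fin 3]→ₗ[ℝ] ℝ) (u : Fin 3 → V) : a u = a ![u 0, u 1, u 2] := by
  congr 1; ext i; fin_cases i <;> rfl

theorem apply_vec_four (a : V [⋀^Fin 4]→ₗ[ℝ] ℝ) (u : Fin 4 → V) :
    a u = a ![u 0, u 1, u 2, u 3] := by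
  congr 1; ext i; fin_cases i <;> rfl

theorem apply_swap_left (a : V [⋀^Fin 3]→ₗ[ℝ] ℝ) (x y z : V) : a ![y, x, z] = -a ![x, y, z] := by
  rw [← a.map_swap ![x, y, z] (show (0 : Fin 3) ≠ 1 by decide)]
  congr 1; ext1 m; fin_cases m <;> rfl

theorem apply_swap_right (a : V [⋀^Fin 3]→ₗ[ℝ] ℝ) (x y z : V) : a ![x, z, y] = -a ![x, y, z] := by
  rw [← a.map_swap ![x, y, z] (show (1 : Fin 3) ≠ 2 by decide)]
  congr 1; ext1 m; fin_cases m <;> rfl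

/-- The components of a 3-form in a basis. -/
def comp (b : Fin 6 → V) (a : V [⋀^Fin 3]→ₗ[ℝ] ℝ) (i j k : Fin 6) : ℝ := a ![b i, b j, b k]

theorem isAlt_comp (b : Fin 6 → V) (a : V [⋀^Fin 3]→ₗ[ℝ] ℝ) : IsAlt (comp b a) :=
  ⟨fun _ _ _ => apply_swap_left a _ _ _, fun _ _ _ => apply_swap_right a _ _ _⟩

/-- Representatives of the `(3, 3)`-shuffles. -/
def shuffles33 : Fin 20 → Equiv.Perm (Fin 3 ⊕ Fin 3) :=
  let t : Fin 3 → Fin 3 → Equiv.Perm (Fin 3 ⊕ Fin 3) := fun i j => Equiv.swap (.inl i) (.inr j)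
  ![1, t 0 0, t 0 1, t 0 2, t 1 0, t 1 1, t 1 2, t 2 0, t 2 1, t 2 2,
    t 0 0 * t 1 1, t 0 0 * t 1 2, t 0 1 * t 1 2, t 0 0 * t 2 1, t 0 0 * t 2 2, t 0 1 * t 2 2,
    t 1 0 * t 2 1, t 1 0 * t 2 2, t 1 1 * t 2 2, t 0 0 * t 1 1 * t 2 2]

/-- Representatives of the `(2, 2)`-shuffles. -/
def shuffles22 : Fin 6 → Equiv.Perm (Fin 2 ⊕ Fin 2) :=
  let t : Fin 2 → Fin 2 → Equiv.Perm (Fin 2 ⊕ Fin 2) := fun i j => Equiv.swap (.inl i) (.inr j)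
  ![1, t 0 0, t 0 1, t 1 0, t 1 1, t 0 0 * t 1 1]

/-- Representatives of the `(4, 2)`-shuffles. -/
def shuffles42 : Fin 15 → Equiv.Perm (Fin 4 ⊕ Fin 2) :=
  let t : Fin 4 → Fin 2 → Equiv.Perm (Fin 4 ⊕ Fin 2) := fun i j => Equiv.swap (.inl i) (.inr j)
  ![1, t 0 0, t 0 1, t 1 0, t 1 1, t 2 0, t 2 1, t 3 0, t 3 1, t 0 0 * t 1 1, t 0 0 * t 2 1,
    t 0 0 * t 3 1, t 1 0 * t 2 1, t 1 0 * t 3 1, t 2 0 * t 3 1]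

theorem wedge_three_three (a c : V [⋀^Fin 3]→ₗ[ℝ] ℝ) (b : Fin 6 → V) :
    wedge (n := 6) rfl a c b = pairing (comp b a) (comp b c) := by
  rw [wedge_eq_sum_shuffles rfl shuffles33 (by decide) (by decide)]
  have hs : ∀ t, Equiv.Perm.sign (shuffles33 t) =
    ![1,-1,-1,-1,-1,-1,-1,-1,-1,-1,1,1,1,1,1,1,1,1,1,-1] t := by decide
  simp only [hs, apply_vec_three _ fun i => b _]
  have hc : ∀ (a : V [⋀^Fin 3]→ₗ[ℝ] ℝ) i j k, a ![b i, b j, b k] = comp b a i j k :=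
    fun _ _ _ _ => rfl
  simp only [hc]
  have e : ∀ t, (∀ i, finCongr (rfl : 3 + 3 = 6) (finSumFinEquiv (shuffles33 t (.inl i))) =
    (![![0,1,2],![3,1,2],![4,1,2],![5,1,2],![0,3,2],![0,4,2],![0,5,2],![0,1,3],![0,1,4],![0,1,5],
      ![3,4,2],![3,5,2],![4,5,2],![3,1,4],![3,1,5],![4,1,5],![0,3,4],![0,3,5],![0,4,5],
      ![3,4,5]] : Fin 20 → Fin 3 → Fin 6) t i) ∧
    (∀ i, finCongr (rfl : 3 + 3 = 6) (finSumFinEquiv (shuffles33 t (.inr i))) =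
    (![![3,4,5],![0,4,5],![3,0,5],![3,4,0],![1,4,5],![3,1,5],![3,4,1],![2,4,5],![3,2,5],![3,4,2],
      ![0,1,5],![0,4,1],![3,0,1],![0,2,5],![0,4,2],![3,0,2],![1,2,5],![1,4,2],![3,1,2],
      ![0,1,2]] : Fin 20 → Fin 3 → Fin 6) t i) := by decide
  have h1 := isAlt_comp b a
  have h2 := isAlt_comp b c
  simp only [fun t => (e t).1, fun t => (e t).2, Fin.sum_univ_succ, pairing]
  simp [h1.sort_left, h1.sort_right, h2.sort_left, h2.sort_right]
  ring

theorem wedge_two_two (a c : V [⋀^Fin 2]→ₗ[ℝ] ℝ) (w : Fin 4 → V) :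
    wedge (n := 4) rfl a c w = a ![w 0, w 1] * c ![w 2, w 3] - a ![w 2, w 1] * c ![w 0, w 3]
      - a ![w 3, w 1] * c ![w 2, w 0] - a ![w 0, w 2] * c ![w 1, w 3]
      - a ![w 0, w 3] * c ![w 2, w 1] + a ![w 2, w 3] * c ![w 0, w 1] := by
  rw [wedge_eq_sum_shuffles rfl shuffles22 (by decide) (by decide)]
  have hs : ∀ t, Equiv.Perm.sign (shuffles22 t) = ![1,-1,-1,-1,-1,1] t := by decide
  simp only [hs, apply_vec_two _ fun i => w _]
  have e : ∀ t, (∀ i, finCongr (rfl : 2 + 2 = 4) (finSumFinEquiv (shuffles22 t (.inl i))) =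
    (![![0,1],![2,1],![3,1],![0,2],![0,3],![2,3]] : Fin 6 → Fin 2 → Fin 4) t i) ∧
    (∀ i, finCongr (rfl : 2 + 2 = 4) (finSumFinEquiv (shuffles22 t (.inr i))) =
    (![![2,3],![0,3],![2,0],![1,3],![2,1],![0,1]] : Fin 6 → Fin 2 → Fin 4) t i) := by decide
  simp only [fun t => (e t).1, fun t => (e t).2, Fin.sum_univ_succ]
  simp
  ring

theorem wedge_four_two (a : V [⋀^Fin 4]→ₗ[ℝ] ℝ) (c : V [⋀^Fin 2]→ₗ[ℝ] ℝ) (w : Fin 6 → V) :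
    wedge (n := 6) rfl a c w = a ![w 0, w 1, w 2, w 3] * c ![w 4, w 5]
      - a ![w 4, w 1, w 2, w 3] * c ![w 0, w 5] - a ![w 5, w 1, w 2, w 3] * c ![w 4, w 0]
      - a ![w 0, w 4, w 2, w 3] * c ![w 1, w 5] - a ![w 0, w 5, w 2, w 3] * c ![w 4, w 1]
      - a ![w 0, w 1, w 4, w 3] * c ![w 2, w 5] - a ![w 0, w 1, w 5, w 3] * c ![w 4, w 2]
      - a ![w 0, w 1, w 2, w 4] * c ![w 3, w 5] - a ![w 0, w 1, w 2, w 5] * c ![w 4, w 3]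
      + a ![w 4, w 5, w 2, w 3] * c ![w 0, w 1] + a ![w 4, w 1, w 5, w 3] * c ![w 0, w 2]
      + a ![w 4, w 1, w 2, w 5] * c ![w 0, w 3] + a ![w 0, w 4, w 5, w 3] * c ![w 1, w 2]
      + a ![w 0, w 4, w 2, w 5] * c ![w 1, w 3] + a ![w 0, w 1, w 4, w 5] * c ![w 2, w 3] := by
  rw [wedge_eq_sum_shuffles rfl shuffles42 (by decide) (by decide)]
  have hs : ∀ t, Equiv.Perm.sign (shuffles42 t) =
    ![1,-1,-1,-1,-1,-1,-1,-1,-1,1,1,1,1,1,1] t := by decide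
  simp only [hs, apply_vec_two _ fun i => w _, apply_vec_four _ fun i => w _]
  have e : ∀ t, (∀ i, finCongr (rfl : 4 + 2 = 6) (finSumFinEquiv (shuffles42 t (.inl i))) =
    (![![0,1,2,3],![4,1,2,3],![5,1,2,3],![0,4,2,3],![0,5,2,3],![0,1,4,3],![0,1,5,3],![0,1,2,4],
      ![0,1,2,5],![4,5,2,3],![4,1,5,3],![4,1,2,5],![0,4,5,3],![0,4,2,5],![0,1,4,5]] :
      Fin 15 → Fin 4 → Fin 6) t i) ∧
    (∀ i, finCongr (rfl : 4 + 2 = 6) (finSumFinEquiv (shuffles42 t (.inr i))) =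
    (![![4,5],![0,5],![4,0],![1,5],![4,1],![2,5],![4,2],![3,5],![4,3],![0,1],![0,2],![0,3],
      ![1,2],![1,3],![2,3]] : Fin 15 → Fin 2 → Fin 6) t i) := by decide
  simp only [fun t => (e t).1, fun t => (e t).2, Fin.sum_univ_succ]
  simp
  ring

theorem apply_swap (a : V [⋀^Fin 2]→ₗ[ℝ] ℝ) (x y : V) : a ![y, x] = -a ![x, y] := by
  rw [← a.map_swap ![x, y] (show (0 : Fin 2) ≠ 1 by decide)]
  congr 1; ext1 m; fin_cases m <;> rfl

/-- The Pfaffian of a 4 × 4 block of a skew-symmetric matrix. -/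
def pfaffian4 (o : Fin 6 → Fin 6 → ℝ) (i j k l : Fin 6) : ℝ :=
  o i j * o k l - o i k * o j l + o i l * o j k

/-- The Pfaffian analogue of the adjugate identity: the matrix of 4 × 4 sub-Pfaffians times `o` is a
scalar matrix, the scalar being the Pfaffian up to sign. -/
theorem sum_bivec_pfaffian4 {o : Fin 6 → Fin 6 → ℝ} (ho : ∀ i j, o j i = -o i j) (c e : Fin 6) :
    ∑ d, bivec (pfaffian4 o) c d * o d e =
      if c = e then -∑ d, bivec (pfaffian4 o) 0 d * o 0 d else 0 := by
  have hd : ∀ i, o i i = 0 := fun i => by linarith [ho i i]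
  have hs : ∀ i j, j < i → o i j = -o j i := fun i j _ => ho j i
  fin_cases c <;> fin_cases e <;>
  · simp [Fin.sum_univ_six, bivec, pfaffian4, hd, hs]
    try ring

theorem liouville_apply (ω : V [⋀^Fin 2]→ₗ[ℝ] ℝ) (b : Fin 6 → V) :
    liouville ω b = ∑ d, bivec (pfaffian4 fun i j => ω ![b i, b j]) 0 d * ω ![b 0, b d] := by
  obtain ⟨o, ho⟩ : ∃ o : Fin 6 → Fin 6 → ℝ, ∀ i j, ω ![b i, b j] = o i j := ⟨_, fun _ _ => rfl⟩
  have hs : ∀ i j, j < i → o i j = -o j i := fun i j _ => by rw [← ho, ← ho, apply_swap]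
  have hd : ∀ i, o i i = 0 := fun i => by
    have := apply_swap ω (b i) (b i)
    rw [ho] at this
    linarith
  rw [liouville, AlternatingMap.smul_apply, wedge_four_two]
  simp only [wedge_two_two, Matrix.cons_val, ho]
  simp [hs, hd, Fin.sum_univ_six, bivec, pfaffian4]
  ring

/-- If the Pfaffian vanished, the rows of the Pfaffian adjugate would lie in the kernel of ω, hence
be zero; then all 4 × 4 sub-Pfaffians vanish, which yields further kernel vectors and finally e₀
itself. -/
theorem liouville_ne_zero (b : Module.Basis (Fin 6) ℝ V) (ω : V [⋀^Fin 2]→ₗ[ℝ] ℝ)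
    (hω : ∀ v, (∀ w, ω ![v, w] = 0) → v = 0) : liouville ω ≠ 0 := by
  intro h0
  obtain ⟨o, ho⟩ : ∃ o : Fin 6 → Fin 6 → ℝ, ∀ i j, ω ![b i, b j] = o i j := ⟨_, fun _ _ => rfl⟩
  have hsw : ∀ i j, o j i = -o i j := fun i j => by rw [← ho, ← ho, apply_swap]
  have hker : ∀ x : Fin 6 → ℝ, (∀ e, ∑ d, x d * o d e = 0) → x = 0 := by
    intro x hx
    have hlin : ∀ v w, ω ![v, w] = (ω.curryLeft v).curryLeft w ![] := fun v w => rfl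
    have : ∑ d, x d • b d = 0 := by
      have hv : ∀ e, ω ![∑ d, x d • b d, b e] = 0 := fun e => by
        have hc : ∀ v, ω ![v, b e] = ω.curryLeft v ![b e] := fun v => rfl
        rw [hc]
        simp only [map_sum, map_smul, sum_alternating_apply, AlternatingMap.smul_apply, ← hc, ho,
          smul_eq_mul, hx]
      generalize ∑ d, x d • b d = v at hv
      refine hω v fun w => ?_
      rw [← b.sum_repr w, hlin]
      simp only [map_sum, map_smul, sum_alternating_apply, AlternatingMap.smul_apply, ← hlin, hv,
        smul_zero, Finset.sum_const_zero]
    exact funext fun i => Fintype.linearIndependent_iff.mp b.linearIndependent x this i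
  have hpf : ∑ d, bivec (pfaffian4 o) 0 d * o 0 d = 0 := by
    have := liouville_apply ω b
    rw [h0] at this
    simp only [ho] at this
    exact this.symm
  have hP : ∀ c d, bivec (pfaffian4 o) c d = 0 := fun c d => by
    refine congrFun (hker (bivec (pfaffian4 o) c) fun e => ?_) d
    rw [sum_bivec_pfaffian4 hsw, hpf]
    simp
  have hd : ∀ i, o i i = 0 := fun i => by linarith [hsw i i]
  have hs : ∀ i j, j < i → o i j = -o j i := fun i j _ => hsw j i
  have h4 : pfaffian4 o 0 1 2 3 = 0 ∧ pfaffian4 o 0 1 2 4 = 0 ∧ pfaffian4 o 0 1 2 5 = 0 ∧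
      pfaffian4 o 0 3 4 5 = 0 ∧ pfaffian4 o 0 1 3 4 = 0 ∧ pfaffian4 o 0 2 3 4 = 0 ∧
      pfaffian4 o 0 1 3 5 = 0 ∧ pfaffian4 o 0 1 4 5 = 0 :=
    ⟨by simpa [bivec] using hP 4 5, by simpa [bivec] using hP 3 5, by simpa [bivec] using hP 3 4,
      by simpa [bivec] using hP 1 2, by simpa [bivec] using hP 2 5, by simpa [bivec] using hP 1 5,
      by simpa [bivec] using hP 2 4, by simpa [bivec] using hP 2 3⟩
  obtain ⟨p1, p2, p3, p4, p5, p6, p7, p8⟩ := h4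
  simp only [pfaffian4] at p1 p2 p3 p4 p5 p6 p7 p8
  -- Pairing this vector with e gives `pfaffian4 o 0 1 2 e`, which is zero. The next two vectors
  -- arise in the same way from the index triples 0 3 4 and 0 1 5. Their vanishing makes the whole
  -- row `o 0` zero.
  have k1 := hker ![o 1 2, -o 0 2, o 0 1, 0, 0, 0] fun e => by
    fin_cases e <;> simp [Fin.sum_univ_six, hd, hs] <;> linarith
  have k2 := hker ![o 3 4, 0, 0, -o 0 4, o 0 3, 0] fun e => by
    fin_cases e <;> simp [Fin.sum_univ_six, hd, hs] <;> linarith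
  have k3 := hker ![o 1 5, -o 0 5, 0, 0, 0, o 0 1] fun e => by
    fin_cases e <;> simp [Fin.sum_univ_six, hd, hs] <;> linarith
  have q1 := congrFun k1 1
  have q2 := congrFun k1 2
  have q3 := congrFun k2 3
  have q4 := congrFun k2 4
  have q5 := congrFun k3 1
  simp at q1 q2 q3 q4 q5
  have := congrFun (hker (Pi.single 0 1) fun e => by
    fin_cases e <;> simp [Pi.single_apply, hd, q1, q2, q3, q4, q5]) 0
  simp at this

theorem liouville_compLinearMap (ω : V [⋀^Fin 2]→ₗ[ℝ] ℝ) (g : V' →ₗ[ℝ] V) :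
    liouville (ω.compLinearMap g) = (liouville ω).compLinearMap g := by
  unfold liouville
  rw [wedge_compLinearMap, wedge_compLinearMap]
  ext w
  simp only [AlternatingMap.smul_apply, AlternatingMap.compLinearMap_apply]

end Wedge

/-! ### The endomorphism K: change of basis, trace and square -/

section Endo
variable {V V' : Type*} [AddCommGroup V] [Module ℝ V] [AddCommGroup V'] [Module ℝ V']

theorem exists_basis_of_linearIndependent_three (b : Module.Basis (Fin 6) ℝ V) {x y z : V}
    (h : LinearIndependent ℝ ![x, y, z]) :
    ∃ b' : Module.Basis (Fin 6) ℝ V, b' 0 = x ∧ b' 1 = y ∧ b' 2 = z := by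
  have := Module.Finite.of_basis b
  have hr : Module.finrank ℝ V = 6 := by simp [Module.finrank_eq_card_basis b]
  obtain ⟨x1, h1⟩ := exists_linearIndependent_snoc_of_lt_finrank h (by rw [hr]; norm_num)
  obtain ⟨x2, h2⟩ := exists_linearIndependent_snoc_of_lt_finrank h1 (by rw [hr]; norm_num)
  obtain ⟨x3, h3⟩ := exists_linearIndependent_snoc_of_lt_finrank h2 (by rw [hr]; norm_num)
  refine ⟨basisOfLinearIndependentOfCardEqFinrank h3 (by rw [hr]; simp), ?_, ?_, ?_⟩ <;>
  · rw [coe_basisOfLinearIndependentOfCardEqFinrank]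
    rfl

theorem exists_basis_of_linearIndependent_two (b : Module.Basis (Fin 6) ℝ V) {x y : V}
    (h : LinearIndependent ℝ ![x, y]) :
    ∃ b' : Module.Basis (Fin 6) ℝ V, b' 0 = x ∧ b' 1 = y := by
  have := Module.Finite.of_basis b
  have hr : Module.finrank ℝ V = 6 := by simp [Module.finrank_eq_card_basis b]
  obtain ⟨x1, h1⟩ := exists_linearIndependent_snoc_of_lt_finrank h (by rw [hr]; norm_num)
  obtain ⟨x2, h2⟩ := exists_linearIndependent_snoc_of_lt_finrank h1 (by rw [hr]; norm_num)
  obtain ⟨x3, h3⟩ := exists_linearIndependent_snoc_of_lt_finrank h2 (by rw [hr]; norm_num)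
  obtain ⟨x4, h4⟩ := exists_linearIndependent_snoc_of_lt_finrank h3 (by rw [hr]; norm_num)
  refine ⟨basisOfLinearIndependentOfCardEqFinrank h4 (by rw [hr]; simp), ?_, ?_⟩ <;>
  · rw [coe_basisOfLinearIndependentOfCardEqFinrank]
    rfl

/-- The polarization of `K`, for an arbitrary volume form `τ`. -/
noncomputable def endo (b : Module.Basis (Fin 6) ℝ V) (τ : V [⋀^Fin 6]→ₗ[ℝ] ℝ)
    (φ ψ : V [⋀^Fin 3]→ₗ[ℝ] ℝ) : V →ₗ[ℝ] V :=
  -(dualVector b τ ∘ₗ wedgeLeft (n := 5) rfl ψ ∘ₗ φ.curryLeft)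

theorem K_eq_endo (b : Module.Basis (Fin 6) ℝ V) (ω : V [⋀^Fin 2]→ₗ[ℝ] ℝ)
    (φ : V [⋀^Fin 3]→ₗ[ℝ] ℝ) : K b ω φ = endo b (liouville ω) φ φ := by
  rw [K, endo]

theorem endo_apply (b : Module.Basis (Fin 6) ℝ V) (τ : V [⋀^Fin 6]→ₗ[ℝ] ℝ)
    (φ ψ : V [⋀^Fin 3]→ₗ[ℝ] ℝ) (v : V) :
    endo b τ φ ψ v = -dualVector b τ (wedge (n := 5) rfl (φ.curryLeft v) ψ) := by
  rw [endo, LinearMap.neg_apply, LinearMap.comp_apply, LinearMap.comp_apply, wedgeLeft_apply]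

theorem endo_eq (b b' : Module.Basis (Fin 6) ℝ V) {τ : V [⋀^Fin 6]→ₗ[ℝ] ℝ} (hτ : τ ≠ 0)
    (φ ψ : V [⋀^Fin 3]→ₗ[ℝ] ℝ) : endo b τ φ ψ = endo b' τ φ ψ := by
  rw [endo, endo, dualVector_eq b b' τ hτ]

theorem dualVector_compLinearMap (b : Module.Basis (Fin 6) ℝ V') (τ : V [⋀^Fin 6]→ₗ[ℝ] ℝ)
    (θ : V [⋀^Fin 5]→ₗ[ℝ] ℝ) (g : V' ≃ₗ[ℝ] V) :
    g (dualVector b (τ.compLinearMap g) (θ.compLinearMap g)) = dualVector (b.map g) τ θ := by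
  rw [dualVector_apply, dualVector_apply, map_sum]
  refine Finset.sum_congr rfl fun i _ => ?_
  rw [map_smul, Module.Basis.map_apply]
  congr 2

/-- Naturality under isomorphisms; the basis is transported along with the forms, and `endo_eq`
removes it afterwards. -/
theorem endo_compLinearMap (b : Module.Basis (Fin 6) ℝ V') (τ : V [⋀^Fin 6]→ₗ[ℝ] ℝ)
    (φ ψ : V [⋀^Fin 3]→ₗ[ℝ] ℝ) (g : V' ≃ₗ[ℝ] V) (v : V') :
    g (endo b (τ.compLinearMap g) (φ.compLinearMap g) (ψ.compLinearMap g) v) =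
      endo (b.map g) τ φ ψ (g v) := by
  have : (φ.compLinearMap g.toLinearMap).curryLeft v =
      (φ.curryLeft (g v)).compLinearMap g.toLinearMap := by
    ext w
    simp only [AlternatingMap.curryLeft_apply_apply, AlternatingMap.compLinearMap_apply]
    congr 1
    ext1 i
    refine Fin.cases rfl (fun j => rfl) i
  rw [endo_apply, endo_apply, map_neg, this, wedge_compLinearMap, dualVector_compLinearMap]

theorem repr_endo (b : Module.Basis (Fin 6) ℝ V) (τ : V [⋀^Fin 6]→ₗ[ℝ] ℝ)
    (φ ψ : V [⋀^Fin 3]→ₗ[ℝ] ℝ) (i j : Fin 6) :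
    b.repr (endo b τ φ ψ (b j)) i = (τ b)⁻¹ * polarK (comp b φ) (comp b ψ) i j := by
  have hsa : ∀ i : Fin 6, i.succAbove = (![![1, 2, 3, 4, 5], ![0, 2, 3, 4, 5], ![0, 1, 3, 4, 5],
    ![0, 1, 2, 4, 5], ![0, 1, 2, 3, 5], ![0, 1, 2, 3, 4]] : Fin 6 → Fin 5 → Fin 6) i := by decide
  have hW : ∀ w : Fin 5 → Fin 6, wedge (n := 5) rfl (φ.curryLeft (b j)) ψ (fun k => b (w k)) =
      wedgeComp (comp b φ) (comp b ψ) j (w 0) (w 1) (w 2) (w 3) (w 4) := fun w => by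
    rw [wedge_two_three]
    rfl
  rw [endo_apply, dualVector_apply, map_neg, Finsupp.neg_apply, b.repr_sum_self, hW, hsa]
  fin_cases i <;> simp [polarK] <;> ring

theorem repr_endo_add (b : Module.Basis (Fin 6) ℝ V) {τ : V [⋀^Fin 6]→ₗ[ℝ] ℝ}
    (φ : V [⋀^Fin 3]→ₗ[ℝ] ℝ) (v : V) (i : Fin 6) :
    b.repr (endo b τ φ φ v) i =
      ∑ j, (τ b)⁻¹ * polarK (comp b φ) (comp b φ) i j * b.repr v j := by
  conv_lhs => rw [← b.sum_repr v]
  simp only [map_sum, map_smul, Finsupp.coe_finsetSum, Finset.sum_apply, Finsupp.smul_apply,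
    repr_endo, smul_eq_mul]
  exact Finset.sum_congr rfl fun j _ => mul_comm _ _

theorem endo_basis (b : Module.Basis (Fin 6) ℝ V) (τ : V [⋀^Fin 6]→ₗ[ℝ] ℝ)
    (φ ψ : V [⋀^Fin 3]→ₗ[ℝ] ℝ) (j : Fin 6) :
    endo b τ φ ψ (b j) = ∑ i, ((τ b)⁻¹ * polarK (comp b φ) (comp b ψ) i j) • b i := by
  rw [← b.sum_repr (endo b τ φ ψ (b j))]
  simp only [repr_endo]

theorem trace_endo (b : Module.Basis (Fin 6) ℝ V) (τ : V [⋀^Fin 6]→ₗ[ℝ] ℝ)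
    (φ : V [⋀^Fin 3]→ₗ[ℝ] ℝ) : LinearMap.trace ℝ V (endo b τ φ φ) = 0 := by
  rw [LinearMap.trace_eq_matrix_trace ℝ b, Matrix.trace]
  simp only [Matrix.diag_apply, LinearMap.toMatrix_apply, repr_endo]
  rw [← Finset.mul_sum, polarK_trace (isAlt_comp b φ), mul_zero]

theorem trace_endo_sq (b : Module.Basis (Fin 6) ℝ V) (τ : V [⋀^Fin 6]→ₗ[ℝ] ℝ)
    (φ : V [⋀^Fin 3]→ₗ[ℝ] ℝ) :
    LinearMap.trace ℝ V (endo b τ φ φ ∘ₗ endo b τ φ φ) =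
      (τ b)⁻¹ ^ 2 * ∑ i, ∑ j, polarK (comp b φ) (comp b φ) i j * polarK (comp b φ) (comp b φ) j i := by
  rw [LinearMap.trace_eq_matrix_trace ℝ b, Matrix.trace, Finset.mul_sum]
  refine Finset.sum_congr rfl fun i _ => ?_
  rw [Matrix.diag_apply, LinearMap.toMatrix_apply, LinearMap.comp_apply, repr_endo_add,
    Finset.mul_sum]
  refine Finset.sum_congr rfl fun j _ => ?_
  rw [repr_endo]
  ring

theorem Q_eq_trace (b : Module.Basis (Fin 6) ℝ V) (ω : V [⋀^Fin 2]→ₗ[ℝ] ℝ)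
    (φ : V [⋀^Fin 3]→ₗ[ℝ] ℝ) :
    Q b ω φ = 2 / 3 * LinearMap.trace ℝ V (K b ω φ ∘ₗ K b ω φ) := by
  have hc : ∀ x y z, φ ![x, y, z] = φ.curryLeft x ![y, z] := fun _ _ _ => rfl
  have hF : ∀ i j k, comp b (contractK b ω φ) i j k = (liouville ω b)⁻¹ *
      ∑ e, polarK (comp b φ) (comp b φ) e i * comp b φ e j k := fun i j k => by
    rw [comp, contractK_apply]
    simp only [Matrix.cons_val]
    rw [K_eq_endo, endo_basis, hc]
    simp only [map_sum, map_smul, sum_alternating_apply, AlternatingMap.smul_apply, ← hc,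
      smul_eq_mul, Finset.mul_sum, mul_assoc]
    rfl
  have hA := isAlt_comp b (contractK b ω φ)
  have hf := isAlt_comp b φ
  -- As φ(Kx, y, z) is alternating, K may be moved to any slot. Averaging over the three slots makes
  -- the form one third of K·φ, the shape needed for `pairing_contract`.
  have hF3 : comp b (contractK b ω φ) = fun i j k => ∑ e,
      ((liouville ω b)⁻¹ / 3 * polarK (comp b φ) (comp b φ) e i * comp b φ e j k +
       (liouville ω b)⁻¹ / 3 * polarK (comp b φ) (comp b φ) e j * comp b φ i e k +
       (liouville ω b)⁻¹ / 3 * polarK (comp b φ) (comp b φ) e k * comp b φ i j e) := by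
    funext i j k
    have h1 := hF i j k
    have h2 := hF j i k
    have h3 := hF k i j
    rw [hA.swap_left] at h2
    rw [hA.swap_left, hA.swap_right, neg_neg] at h3
    have e2 : ∀ e, comp b φ e i k = -comp b φ i e k := fun e => hf.swap_left _ _ _
    have e3 : ∀ e, comp b φ e i j = comp b φ i j e := fun e => by
      rw [hf.swap_left, hf.swap_right, neg_neg]
    simp only [e2, e3, Finset.mul_sum, mul_neg, Finset.sum_neg_distrib, neg_inj] at h1 h2 h3
    have := congrArg₂ (· + ·) (congrArg₂ (· + ·) h1 h2) h3
    simp only [← Finset.sum_add_distrib] at this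
    rw [show comp b (contractK b ω φ) i j k = (comp b (contractK b ω φ) i j k +
      comp b (contractK b ω φ) i j k + comp b (contractK b ω φ) i j k) / 3 by ring, this,
      Finset.sum_div]
    exact Finset.sum_congr rfl fun e _ => by ring
  rw [Q, F, K_eq_endo, trace_endo_sq, wedge_three_three]
  have hsm : comp b ((-2 : ℝ) • contractK b ω φ) = fun i j k =>
      ∑ e, (-2 * ((liouville ω b)⁻¹ / 3 * polarK (comp b φ) (comp b φ) e i) * comp b φ e j k +
        -2 * ((liouville ω b)⁻¹ / 3 * polarK (comp b φ) (comp b φ) e j) * comp b φ i e k +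
        -2 * ((liouville ω b)⁻¹ / 3 * polarK (comp b φ) (comp b φ) e k) * comp b φ i j e) := by
    funext i j k
    rw [comp, AlternatingMap.smul_apply, ← comp, hF3, smul_eq_mul, Finset.mul_sum]
    exact Finset.sum_congr rfl fun e _ => by ring
  rw [hsm, pairing_contract hf]
  simp only [mul_assoc, ← Finset.mul_sum]
  ring

/-- If v and K²v were independent, a basis starting with K²v, v would have 1 as its (0, 1) entry of
K², against `polarK_sq_offdiag`. So every vector is an eigenvector of K², and K² is scalar. -/
theorem exists_endo_sq_eq_smul (b : Module.Basis (Fin 6) ℝ V) {τ : V [⋀^Fin 6]→ₗ[ℝ] ℝ} (hτ : τ ≠ 0)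
    (φ : V [⋀^Fin 3]→ₗ[ℝ] ℝ) :
    ∃ c : ℝ, endo b τ φ φ ∘ₗ endo b τ φ φ = c • 1 := by
  have := Module.Free.of_basis b
  refine LinearMap.exists_eq_smul_id_of_forall_notLinearIndependent fun v hv => ?_
  have hv' := LinearIndependent.pair_symm_iff.mp hv
  obtain ⟨b', h0, h1⟩ := exists_basis_of_linearIndependent_two b hv'
  have h2 : b'.repr (endo b τ φ φ (endo b τ φ φ v)) 0 = 1 := by
    rw [LinearMap.comp_apply] at h0
    rw [← h0]
    simp
  rw [endo_eq b b' hτ, ← h1, repr_endo_add] at h2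
  simp only [repr_endo] at h2
  have h3 := polarK_sq_offdiag (isAlt_comp b' φ)
  have : ∑ j, (τ b')⁻¹ * polarK (comp b' φ) (comp b' φ) 0 j *
      ((τ b')⁻¹ * polarK (comp b' φ) (comp b' φ) j 1) = (τ b')⁻¹ ^ 2 *
      ∑ j, polarK (comp b' φ) (comp b' φ) 0 j * polarK (comp b' φ) (comp b' φ) j 1 := by
    rw [Finset.mul_sum]
    exact Finset.sum_congr rfl fun j _ => by ring
  rw [this, h3, mul_zero] at h2
  exact zero_ne_one h2

end Endo

/-! ### Differentiating components -/

section Calculus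

theorem apply_eq_sum_repr {V : Type*} [AddCommGroup V] [Module ℝ V] (b : Module.Basis (Fin 6) ℝ V)
    (a : V [⋀^Fin 3]→ₗ[ℝ] ℝ) (x v w : V) :
    a ![x, v, w] = ∑ e, b.repr x e * a ![b e, v, w] := by
  have hc : ∀ x, a ![x, v, w] = a.curryLeft x ![v, w] := fun _ => rfl
  conv_lhs => rw [hc, ← b.sum_repr x]
  simp only [map_sum, map_smul, sum_alternating_apply, AlternatingMap.smul_apply, ← hc, smul_eq_mul]

/-- A linear left inverse of J is continuous, its source being finite-dimensional, and it recovers h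
from its coordinates. -/
theorem differentiableAt_of_injective {G ι : Type*} [Finite ι] [NormedAddCommGroup G]
    [NormedSpace ℝ G] (J : G →ₗ[ℝ] ι → ℝ) (hJ : LinearMap.ker J = ⊥) {h : E6 → G} {y : E6}
    (hd : ∀ i, DifferentiableAt ℝ (fun z => J (h z) i) y) : DifferentiableAt ℝ h y := by
  have := Fintype.ofFinite ι
  obtain ⟨J', hJ'⟩ := J.exists_leftInverse_of_injective hJ
  have h1 : h = fun z => LinearMap.toContinuousLinearMap J' (J (h z)) := by
    funext z
    exact (LinearMap.congr_fun hJ' (h z)).symm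
  rw [h1]
  exact (ContinuousLinearMap.differentiableAt _).comp y (differentiableAt_pi.mpr hd)

theorem differentiableAt_alternating {k : ℕ} {h : E6 → E6 [⋀^Fin k]→L[ℝ] ℝ} {y : E6}
    (hd : ∀ v : Fin k → E6, DifferentiableAt ℝ (fun z => h z v) y) : DifferentiableAt ℝ h y := by
  let J : (E6 [⋀^Fin k]→L[ℝ] ℝ) →ₗ[ℝ] (Fin k → Fin 6) → ℝ :=
    { toFun := fun a w => a fun i => stdBasis (w i)
      map_add' := fun _ _ => rfl
      map_smul' := fun _ _ => rfl }
  refine differentiableAt_of_injective J (LinearMap.ker_eq_bot'.mpr fun a ha => ?_)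
    fun w => hd _
  apply ContinuousAlternatingMap.toAlternatingMap_injective
  exact Module.Basis.ext_alternating stdBasis fun v _ => congrFun ha v

theorem differentiableAt_clm {h : E6 → E6 →L[ℝ] E6} {y : E6}
    (hd : ∀ i j, DifferentiableAt ℝ (fun z => stdBasis.repr (h z (stdBasis j)) i) y) :
    DifferentiableAt ℝ h y := by
  let J : (E6 →L[ℝ] E6) →ₗ[ℝ] (Fin 6 × Fin 6) → ℝ :=
    { toFun := fun T w => stdBasis.repr (T (stdBasis w.2)) w.1
      map_add' := fun _ _ => by ext; simp
      map_smul' := fun _ _ => by ext; simp }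
  refine differentiableAt_of_injective J (LinearMap.ker_eq_bot'.mpr fun T hT => ?_)
    fun w => hd _ _
  apply ContinuousLinearMap.coe_injective
  refine stdBasis.ext fun j => stdBasis.repr.injective (Finsupp.ext fun i => ?_)
  have h0 : stdBasis.repr (T (stdBasis j)) i = 0 := congrFun hT (i, j)
  exact h0.trans (by simp)

theorem HasDerivAt.wedgeComp {f g : ℝ → Fin 6 → Fin 6 → Fin 6 → ℝ}
    {p q : Fin 6 → Fin 6 → Fin 6 → ℝ}
    {t : ℝ} (hf : ∀ i j k, HasDerivAt (fun t => f t i j k) (p i j k) t)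
    (hg : ∀ i j k, HasDerivAt (fun t => g t i j k) (q i j k) t) (v a b c d e : Fin 6) :
    HasDerivAt (fun t => wedgeComp (f t) (g t) v a b c d e)
      (wedgeComp (f t) q v a b c d e + wedgeComp p (g t) v a b c d e) t := by
  have h := fun i j k l m n => (hf i j k).mul (hg l m n)
  unfold ThreeForm.wedgeComp
  refine (((((((((h v a b c d e).sub (h v a c b d e)).sub (h v a d c b e)).sub
    (h v a e c d b)).sub (h v c b a d e)).sub (h v d b c a e)).sub (h v e b c d a)).add
    (h v c d a b e)).add (h v c e a d b)).add (h v d e c a b) |>.congr_deriv ?_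
  ring

theorem HasDerivAt.polarK {f : ℝ → Fin 6 → Fin 6 → Fin 6 → ℝ} {p : Fin 6 → Fin 6 → Fin 6 → ℝ}
    {t : ℝ} (hf : ∀ i j k, HasDerivAt (fun t => f t i j k) (p i j k) t) (i j : Fin 6) :
    HasDerivAt (fun t => polarK (f t) (f t) i j) (polarK (f t) p i j + polarK p (f t) i j) t := by
  have h := HasDerivAt.wedgeComp hf hf
  unfold ThreeForm.polarK
  fin_cases i <;> simp only [Matrix.cons_val, Fin.zero_eta, Fin.mk_one, Fin.reduceFinMk]
  · exact (h j 1 2 3 4 5).fun_neg.congr_deriv (by ring)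
  · exact h j 0 2 3 4 5
  · exact (h j 0 1 3 4 5).fun_neg.congr_deriv (by ring)
  · exact h j 0 1 2 4 5
  · exact (h j 0 1 2 3 5).fun_neg.congr_deriv (by ring)
  · exact h j 0 1 2 3 4

theorem hasDerivAt_line {G : Type*} [NormedAddCommGroup G] [NormedSpace ℝ G] {h : E6 → G}
    {y : E6} (hd : DifferentiableAt ℝ h y) (u : E6) :
    HasDerivAt (fun t : ℝ => h (y + t • u)) (fderiv ℝ h y u) 0 := by
  have h1 : HasDerivAt (fun t : ℝ => y + t • u) u 0 := by
    simpa using ((hasDerivAt_id (0 : ℝ)).smul_const u).const_add y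
  have h2 : HasFDerivAt h (fderiv ℝ h y) (y + (0 : ℝ) • u) := by simpa using hd.hasFDerivAt
  exact h2.comp_hasDerivAt 0 h1

end Calculus

/-! ### Fields of forms on ℝ⁶: differentiability of K and F -/

section Flat

/-- `K(φ)` as a continuous linear map. -/
noncomputable def continuousK (ω : E6 [⋀^Fin 2]→L[ℝ] ℝ) (φ : E6 [⋀^Fin 3]→L[ℝ] ℝ) : E6 →L[ℝ] E6 :=
  LinearMap.toContinuousLinearMap (K stdBasis ω.toAlternatingMap φ.toAlternatingMap)

theorem continuousK_apply (ω : E6 [⋀^Fin 2]→L[ℝ] ℝ) (φ : E6 [⋀^Fin 3]→L[ℝ] ℝ) (v : E6) :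
    continuousK ω φ v = K stdBasis ω.toAlternatingMap φ.toAlternatingMap v := rfl

theorem repr_continuousK (b : Module.Basis (Fin 6) ℝ E6) (ω : E6 [⋀^Fin 2]→L[ℝ] ℝ)
    (φ : E6 [⋀^Fin 3]→L[ℝ] ℝ) (h : liouville ω.toAlternatingMap ≠ 0) (i j : Fin 6) :
    b.repr (continuousK ω φ (b j)) i = (liouville ω.toAlternatingMap b)⁻¹ *
      polarK (comp b φ.toAlternatingMap) (comp b φ.toAlternatingMap) i j := by
  rw [continuousK_apply, K_eq _ b _ _ h, K_eq_endo, repr_endo]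

variable {W : E6 → E6 [⋀^Fin 2]→L[ℝ] ℝ} {Φ : E6 → E6 [⋀^Fin 3]→L[ℝ] ℝ} {y : E6}

theorem differentiableAt_apply {k : ℕ} {Φ : E6 → E6 [⋀^Fin k]→L[ℝ] ℝ}
    (hΦ : DifferentiableAt ℝ Φ y) (v : Fin k → E6) : DifferentiableAt ℝ (fun z => Φ z v) y := by
  have := hΦ.continuousAlternatingMap_apply_const v
  exact this

theorem differentiableAt_liouville (hW : DifferentiableAt ℝ W y) (b : Fin 6 → E6) :
    DifferentiableAt ℝ (fun z => liouville (W z).toAlternatingMap b) y := by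
  have h := fun i j => differentiableAt_apply hW ![b i, b j]
  simp only [liouville_apply, ContinuousAlternatingMap.coe_toAlternatingMap]
  simp only [Fin.sum_univ_six, bivec, pfaffian4, Matrix.cons_val]
  fun_prop

theorem eventually_liouville_ne_zero (hW : DifferentiableAt ℝ W y)
    (h : liouville (W y).toAlternatingMap ≠ 0) :
    ∀ᶠ z in nhds y, liouville (W z).toAlternatingMap ≠ 0 := by
  have h0 := apply_basis_ne_zero stdBasis _ h
  filter_upwards [(differentiableAt_liouville hW stdBasis).continuousAt.eventually_ne h0] with z hz h1
  rw [h1] at hz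
  exact hz rfl

theorem differentiableAt_polarK {f : E6 → Fin 6 → Fin 6 → Fin 6 → ℝ}
    (hf : ∀ i j k, DifferentiableAt ℝ (fun z => f z i j k) y) (i j : Fin 6) :
    DifferentiableAt ℝ (fun z => polarK (f z) (f z) i j) y := by
  unfold polarK wedgeComp
  fin_cases i <;> simp only [Matrix.cons_val, Fin.zero_eta, Fin.mk_one, Fin.reduceFinMk] <;>
    fun_prop

theorem differentiableAt_comp (hΦ : DifferentiableAt ℝ Φ y) (b : Fin 6 → E6) (i j k : Fin 6) :
    DifferentiableAt ℝ (fun z => comp b (Φ z).toAlternatingMap i j k) y :=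
  differentiableAt_apply hΦ ![b i, b j, b k]

theorem differentiableAt_continuousK (hW : DifferentiableAt ℝ W y) (hΦ : DifferentiableAt ℝ Φ y)
    (h : liouville (W y).toAlternatingMap ≠ 0) :
    DifferentiableAt ℝ (fun z => continuousK (W z) (Φ z)) y := by
  refine differentiableAt_clm fun i j => ?_
  have h0 := apply_basis_ne_zero stdBasis _ h
  have : (fun z => stdBasis.repr (continuousK (W z) (Φ z) (stdBasis j)) i) =ᶠ[nhds y] fun z =>
      (liouville (W z).toAlternatingMap stdBasis)⁻¹ * polarK
        (comp stdBasis (Φ z).toAlternatingMap) (comp stdBasis (Φ z).toAlternatingMap) i j := by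
    filter_upwards [eventually_liouville_ne_zero hW h] with z hz
    exact repr_continuousK _ _ _ hz i j
  refine DifferentiableAt.congr_of_eventuallyEq ?_ this
  exact ((differentiableAt_liouville hW _).inv h0).mul
    (differentiableAt_polarK (differentiableAt_comp hΦ _) i j)

theorem differentiableAt_continuousF (hW : DifferentiableAt ℝ W y) (hΦ : DifferentiableAt ℝ Φ y)
    (h : liouville (W y).toAlternatingMap ≠ 0) :
    DifferentiableAt ℝ (fun z => continuousF (W z) (Φ z)) y := by
  refine differentiableAt_alternating fun v => ?_
  have hK := differentiableAt_continuousK hW hΦ h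
  have h1 : ∀ z, continuousF (W z) (Φ z) v =
      -2 * ∑ e, stdBasis.repr (continuousK (W z) (Φ z) (v 0)) e *
        Φ z ![stdBasis e, v 1, v 2] := fun z => by
    rw [continuousF_apply, ← continuousK_apply]
    exact congrArg _ (apply_eq_sum_repr stdBasis (Φ z).toAlternatingMap _ _ _)
  simp only [h1]
  refine DifferentiableAt.const_mul (DifferentiableAt.fun_sum fun e _ => ?_) _
  refine DifferentiableAt.mul ?_ (differentiableAt_apply hΦ _)
  exact (EuclideanSpace.proj e : E6 →L[ℝ] ℝ).differentiableAt.comp y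
    (hK.clm_apply (differentiableAt_const _))

end Flat

/-! ### Vanishing of the Nijenhuis tensor on ℝ⁶ -/

section Flat
variable {W : E6 → E6 [⋀^Fin 2]→L[ℝ] ℝ} {Φ : E6 → E6 [⋀^Fin 3]→L[ℝ] ℝ} {y : E6}

theorem continuousF_vec (ω : E6 [⋀^Fin 2]→L[ℝ] ℝ) (φ : E6 [⋀^Fin 3]→L[ℝ] ℝ) (x v w : E6) :
    continuousF ω φ ![x, v, w] = -2 * φ.toAlternatingMap ![continuousK ω φ x, v, w] := by
  rw [continuousF_apply, continuousK_apply]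
  simp only [Matrix.cons_val, ContinuousAlternatingMap.coe_toAlternatingMap]

theorem extDeriv_eq_alt4 {Ψ : E6 → E6 [⋀^Fin 3]→L[ℝ] ℝ} (hΨ : DifferentiableAt ℝ Ψ y)
    (b : Fin 6 → E6) (i j k l : Fin 6) :
    extDeriv Ψ y ![b i, b j, b k, b l] =
      alt4 (fun u => comp b (fderiv ℝ Ψ y (b u)).toAlternatingMap) i j k l := by
  have h1 : ∀ v : Fin 3 → E6, ∀ u, fderiv ℝ (fun z => Ψ z v) y u = fderiv ℝ Ψ y u v :=
    fun v u => by rw [fderiv_continuousAlternatingMap_apply_const_apply hΨ]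
  rw [extDeriv_apply hΨ]
  simp only [h1]
  refine (Fin.sum_univ_four _).trans ?_
  have r0 : (0 : Fin 4).removeNth ![b i, b j, b k, b l] = ![b j, b k, b l] := by
    ext1 m; fin_cases m <;> rfl
  have r1 : (1 : Fin 4).removeNth ![b i, b j, b k, b l] = ![b i, b k, b l] := by
    ext1 m; fin_cases m <;> rfl
  have r2 : (2 : Fin 4).removeNth ![b i, b j, b k, b l] = ![b i, b j, b l] := by
    ext1 m; fin_cases m <;> rfl
  have r3 : (3 : Fin 4).removeNth ![b i, b j, b k, b l] = ![b i, b j, b k] := by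
    ext1 m; fin_cases m <;> rfl
  rw [r0, r1, r2, r3]
  simp [alt4, comp]
  ring

/-- The components of `K` and its first derivatives at a point where `dφ = 0` and `dF(φ) = 0`. -/
theorem exists_components (hW : DifferentiableAt ℝ W y) (hΦ : DifferentiableAt ℝ Φ y)
    (h : liouville (W y).toAlternatingMap ≠ 0) (hA : extDeriv Φ y = 0)
    (hB : extDeriv (fun z => continuousF (W z) (Φ z)) y = 0) (b : Module.Basis (Fin 6) ℝ E6) :
    ∃ (f : Fin 6 → Fin 6 → Fin 6 → ℝ) (p : Fin 6 → Fin 6 → Fin 6 → Fin 6 → ℝ) (s : ℝ)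
      (β : Fin 6 → ℝ) (D : Fin 6 → Fin 6 → Fin 6 → ℝ), IsAlt f ∧ (∀ u, IsAlt (p u)) ∧
      (∀ i j, b.repr (continuousK (W y) (Φ y) (b j)) i = s * polarK f f i j) ∧
      (∀ u i j, b.repr (fderiv ℝ (fun z => continuousK (W z) (Φ z)) y (b u) (b j)) i = D u i j) ∧
      (∀ u i j, D u i j = s * (polarK f (p u) i j + polarK (p u) f i j) + β u * polarK f f i j) ∧
      (∀ i j k l, alt4 p i j k l = 0) ∧
      (∀ i j k l, alt4 (fun u j l m => ∑ e, (D u e j * f e l m + s * polarK f f e j * p u e l m))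
        i j k l = 0) := by
  have h0 := apply_basis_ne_zero b _ h
  have hK := differentiableAt_continuousK hW hΦ h
  have hF := differentiableAt_continuousF hW hΦ h
  set D : Fin 6 → Fin 6 → Fin 6 → ℝ := fun u i j =>
    b.repr (fderiv ℝ (fun z => continuousK (W z) (Φ z)) y (b u) (b j)) i with hD
  set p : Fin 6 → Fin 6 → Fin 6 → Fin 6 → ℝ :=
    fun u => comp b (fderiv ℝ Φ y (b u)).toAlternatingMap with hp
  set f := comp b (Φ y).toAlternatingMap with hf
  have hline : ∀ u i j k, HasDerivAt (fun t : ℝ => comp b (Φ (y + t • b u)).toAlternatingMap i j k)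
      (p u i j k) 0 := fun u i j k => by
    have h1 := hasDerivAt_line (differentiableAt_apply hΦ ![b i, b j, b k]) (b u)
    rw [fderiv_continuousAlternatingMap_apply_const_apply hΦ] at h1
    exact h1
  have hKline : ∀ u i j, HasDerivAt
      (fun t : ℝ => b.repr (continuousK (W (y + t • b u)) (Φ (y + t • b u)) (b j)) i) (D u i j) 0 :=
    fun u i j => by
      have h1 := (hasDerivAt_line hK (b u)).clm_apply (hasDerivAt_const (0 : ℝ) (b j))
      have h2 := ((LinearMap.toContinuousLinearMap (b.coord i)).hasFDerivAt
        (x := continuousK (W (y + (0 : ℝ) • b u)) (Φ (y + (0 : ℝ) • b u)) (b j))).comp_hasDerivAt 0 h1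
      exact h2.congr_deriv (by simp [hD])
  have htend : ∀ u, Filter.Tendsto (fun t : ℝ => y + t • b u) (nhds 0) (nhds y) := fun u => by
    have : Continuous fun t : ℝ => y + t • b u := by fun_prop
    simpa using this.tendsto 0
  -- Here s is the reciprocal of the volume of the fixed basis b, and β u is the derivative of that
  -- reciprocal along b u.
  refine ⟨f, p, (liouville (W y).toAlternatingMap b)⁻¹, fun u => deriv (fun t : ℝ =>
    (liouville (W (y + t • b u)).toAlternatingMap b)⁻¹) 0, D, isAlt_comp _ _,
    fun u => isAlt_comp _ _, fun i j => repr_continuousK b _ _ h i j, fun _ _ _ => rfl, ?_, ?_, ?_⟩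
  · intro u i j
    have h1 : HasDerivAt (fun t : ℝ => (liouville (W (y + t • b u)).toAlternatingMap b)⁻¹)
        (deriv (fun t : ℝ => (liouville (W (y + t • b u)).toAlternatingMap b)⁻¹) 0) 0 :=
      (hasDerivAt_line ((differentiableAt_liouville hW b).inv h0) (b u)).differentiableAt.hasDerivAt
    have h2 := h1.mul (HasDerivAt.polarK (hline u) i j)
    have h3 : (fun t : ℝ => b.repr (continuousK (W (y + t • b u)) (Φ (y + t • b u)) (b j)) i)
        =ᶠ[nhds 0] fun t : ℝ => (liouville (W (y + t • b u)).toAlternatingMap b)⁻¹ *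
          polarK (comp b (Φ (y + t • b u)).toAlternatingMap)
            (comp b (Φ (y + t • b u)).toAlternatingMap) i j := by
      filter_upwards [(htend u).eventually (eventually_liouville_ne_zero hW h)] with t ht
      exact repr_continuousK b _ _ ht i j
    -- The product rule for K = s · `polarK`, an equality valid only near y, where the volume form
    -- does not vanish.
    have h4 := ((hKline u i j).congr_of_eventuallyEq h3.symm).unique h2
    rw [h4]
    simp only [zero_smul, add_zero, ← hf]
    ring
  · intro i j k l
    rw [hp, ← extDeriv_eq_alt4 hΦ, hA]
    rfl
  · intro i j k l
    have h1 : ∀ u j l m, comp b (fderiv ℝ (fun z => continuousF (W z) (Φ z)) y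
        (b u)).toAlternatingMap j l m = -2 * ∑ e, (D u e j * f e l m +
          (liouville (W y).toAlternatingMap b)⁻¹ * polarK f f e j * p u e l m) := by
      intro u j l m
      have h2 := hasDerivAt_line (differentiableAt_apply hF ![b j, b l, b m]) (b u)
      rw [fderiv_continuousAlternatingMap_apply_const_apply hF] at h2
      have h3 : ∀ z, continuousF (W z) (Φ z) ![b j, b l, b m] =
          -2 * ∑ e, b.repr (continuousK (W z) (Φ z) (b j)) e *
            comp b (Φ z).toAlternatingMap e l m := fun z => by
        rw [continuousF_vec, apply_eq_sum_repr b]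
        rfl
      simp only [h3] at h2
      have h4 := (HasDerivAt.fun_sum (u := Finset.univ) fun e _ =>
        (hKline u e j).mul (hline u e l m)).const_mul (-2 : ℝ)
      have h5 := h2.unique h4
      simp only [zero_smul, add_zero, repr_continuousK b _ _ h, ← hf] at h5
      exact h5
    have h2 := extDeriv_eq_alt4 hF b i j k l
    rw [hB] at h2
    have h3 : (0 : ℝ) = alt4 (fun u => comp b (fderiv ℝ (fun z => continuousF (W z) (Φ z)) y
      (b u)).toAlternatingMap) i j k l := h2
    simp only [alt4, h1] at h3 ⊢
    linarith

/-- The Nijenhuis tensor of a field `K` of endomorphisms with value `A` and derivative `A'`. -/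
noncomputable def nijenhuisTensor (A : E6 →L[ℝ] E6) (A' : E6 →L[ℝ] E6 →L[ℝ] E6) (X Y : E6) : E6 :=
  A (A' X Y) - A (A' Y X) - A' (A X) Y + A' (A Y) X

theorem nijenhuisTensor_swap (A : E6 →L[ℝ] E6) (A' : E6 →L[ℝ] E6 →L[ℝ] E6) (X Y : E6) :
    nijenhuisTensor A A' Y X = -nijenhuisTensor A A' X Y := by
  simp only [nijenhuisTensor]
  abel

theorem repr_nijenhuisTensor (b : Module.Basis (Fin 6) ℝ E6) (A : E6 →L[ℝ] E6)
    (A' : E6 →L[ℝ] E6 →L[ℝ] E6) (k : Fin 6 → Fin 6 → ℝ) (D : Fin 6 → Fin 6 → Fin 6 → ℝ)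
    (hA : ∀ i j, b.repr (A (b j)) i = k i j) (hA' : ∀ u i j, b.repr (A' (b u) (b j)) i = D u i j)
    (c i j : Fin 6) :
    b.repr (nijenhuisTensor A A' (b i) (b j)) c =
      ∑ e, k c e * (D i e j - D j e i) - ∑ u, (k u i * D u c j - k u j * D u c i) := by
  have h1 : ∀ v c, b.repr (A v) c = ∑ e, b.repr v e * k c e := fun v c => by
    conv_lhs => rw [← b.sum_repr v]
    simp only [map_sum, map_smul, Finsupp.coe_finsetSum, Finset.sum_apply, Finsupp.smul_apply, hA,
      smul_eq_mul]
  have h2 : ∀ v j c, b.repr (A' v (b j)) c = ∑ u, b.repr v u * D u c j := fun v j c => by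
    conv_lhs => rw [← b.sum_repr v]
    simp only [map_sum, map_smul, _root_.sum_apply, _root_.smul_apply, Finsupp.coe_finsetSum,
      Finset.sum_apply, Finsupp.smul_apply, hA', smul_eq_mul]
  have t1 := h1 (A' (b i) (b j)) c
  have t2 := h1 (A' (b j) (b i)) c
  have t3 := h2 (A (b i)) j c
  have t4 := h2 (A (b j)) i c
  simp only [hA, hA'] at t1 t2 t3 t4
  simp only [nijenhuisTensor, map_add, map_sub, Finsupp.add_apply, Finsupp.sub_apply, t1, t2, t3,
    t4, mul_sub, Finset.sum_sub_distrib]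
  simp only [mul_comm]
  ring

/-- Two component identities suffice because they hold in every basis: the basis is adapted to X, Y
and, when it is independent of them, to N(X, Y). -/
theorem nijenhuisTensor_eq_zero (hW : DifferentiableAt ℝ W y) (hΦ : DifferentiableAt ℝ Φ y)
    (h : liouville (W y).toAlternatingMap ≠ 0) (hA : extDeriv Φ y = 0)
    (hB : extDeriv (fun z => continuousF (W z) (Φ z)) y = 0) (X Y : E6) :
    nijenhuisTensor (continuousK (W y) (Φ y)) (fderiv ℝ (fun z => continuousK (W z) (Φ z)) y) X Y
      = 0 := by
  have key : ∀ b : Module.Basis (Fin 6) ℝ E6, ∀ c, c = 0 ∨ c = 2 →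
      b.repr (nijenhuisTensor (continuousK (W y) (Φ y))
        (fderiv ℝ (fun z => continuousK (W z) (Φ z)) y) (b 0) (b 1)) c = 0 := by
    intro b c hc
    obtain ⟨f, p, s, β, D, hf, hp, hK, hK', hD, ha, hb⟩ := exists_components hW hΦ h hA hB b
    rw [repr_nijenhuisTensor b _ _ _ D hK hK']
    have hbz : ∀ P : Fin 6 → Fin 6 → Fin 6 → Fin 6 → ℝ, (∀ i j k l, P i j k l = 0) →
        ∀ d e, bivec P d e = 0 := fun P hP d e => by
      simp only [bivec, hP, neg_zero]
      fin_cases d <;> fin_cases e <;> rfl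
    -- The component identities use the matrix without the volume factor, so one s is taken out.
    have e1 : ∀ c, ∑ e, s * polarK f f c e * (D 0 e 1 - D 1 e 0) -
        ∑ u, (s * polarK f f u 0 * D u c 1 - s * polarK f f u 1 * D u c 0) =
        s * (∑ e, polarK f f c e * (D 0 e 1 - D 1 e 0) -
        ∑ u, (polarK f f u 0 * D u c 1 - polarK f f u 1 * D u c 0)) := fun c => by
      rw [mul_sub, Finset.mul_sum, Finset.mul_sum]
      congr 1 <;> exact Finset.sum_congr rfl fun e _ => by ring
    rw [e1]
    rcases hc with rfl | rfl
    · rw [nijenhuisComp_zero f hf p hp s β _ D (fun _ _ => rfl) hD]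
      simp [hbz _ ha, hbz _ hb]
    · rw [nijenhuisComp_two f hf p hp s β _ D (fun _ _ => rfl) hD]
      simp [hbz _ ha, hbz _ hb]
  set N := nijenhuisTensor (continuousK (W y) (Φ y))
    (fderiv ℝ (fun z => continuousK (W z) (Φ z)) y) with hN
  have hsw : ∀ X Y, N Y X = -N X Y := nijenhuisTensor_swap _ _
  by_cases h2 : LinearIndependent ℝ ![X, Y]
  · by_cases h3 : LinearIndependent ℝ ![X, Y, N X Y]
    · obtain ⟨b, hb0, hb1, hb2⟩ := exists_basis_of_linearIndependent_three stdBasis h3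
      have := key b 2 (Or.inr rfl)
      rw [hb0, hb1, ← hb2] at this
      simp at this
    · obtain ⟨b, hb0, hb1⟩ := exists_basis_of_linearIndependent_two stdBasis h2
      have h4 : N X Y ∈ Submodule.span ℝ {X, Y} := by
        by_contra hcon
        apply h3
        have := h2.finSnoc (x := N X Y) (by simpa [Set.pair_comm Y X] using hcon)
        have e : (Fin.snoc ![X, Y] (N X Y) : Fin 3 → E6) = ![X, Y, N X Y] := by
          ext1 i
          fin_cases i <;> rfl
        exact e ▸ this
      obtain ⟨α, γ, hαγ⟩ := Submodule.mem_span_pair.mp h4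
      have k0 := key b 0 (Or.inl rfl)
      -- Exchanging the first two basis vectors turns the vanishing of the component along X into
      -- that of the component along Y.
      have k1 := key (b.reindex (Equiv.swap 0 1)) 0 (Or.inl rfl)
      simp only [Module.Basis.reindex_apply, Equiv.symm_swap, Equiv.swap_apply_left,
        Equiv.swap_apply_right, Module.Basis.repr_reindex_apply] at k1
      rw [hsw] at k1
      rw [hb0, hb1, ← hαγ, ← hb0, ← hb1] at k0 k1
      simp at k0 k1
      rw [← hαγ, k0, k1]
      simp
  · rw [LinearIndependent.pair_iff] at h2
    push Not at h2
    obtain ⟨s, t, hst, hne⟩ := h2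
    have hself : ∀ X, N X X = 0 := fun X => by
      simp [hN, nijenhuisTensor]
    by_cases hs : s = 0
    · have hY : Y = 0 := by
        rw [hs, zero_smul, zero_add] at hst
        exact (smul_eq_zero.mp hst).resolve_left (hne hs)
      simp [hN, hY, nijenhuisTensor]
    · have hX : X = -(s⁻¹ * t) • Y := by
        have := congrArg (fun v => s⁻¹ • v) hst
        simp only [smul_add, smul_smul, inv_mul_cancel₀ hs, one_smul, smul_zero] at this
        rw [neg_smul]
        exact eq_neg_of_add_eq_zero_left this
      have h5 := hself Y
      simp only [hN, nijenhuisTensor] at h5 ⊢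
      rw [hX]
      simp only [map_smul, _root_.smul_apply, ← smul_sub, ← smul_add, h5, smul_zero]

end Flat

/-! ### The differential of Q and the bracket formula on ℝ⁶ -/

section FlatConsequences
variable {W : E6 → E6 [⋀^Fin 2]→L[ℝ] ℝ} {Φ : E6 → E6 [⋀^Fin 3]→L[ℝ] ℝ} {y : E6}

/-- The trace of a continuous endomorphism, as a continuous linear map. -/
noncomputable def traceCLM : (E6 →L[ℝ] E6) →L[ℝ] ℝ :=
  LinearMap.toContinuousLinearMap (LinearMap.trace ℝ E6 ∘ₗ ContinuousLinearMap.coeLM ℝ)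

theorem traceCLM_apply (A : E6 →L[ℝ] E6) :
    traceCLM A = LinearMap.trace ℝ E6 (A : E6 →ₗ[ℝ] E6) := rfl

theorem traceCLM_comp_comm (A B : E6 →L[ℝ] E6) : traceCLM (A.comp B) = traceCLM (B.comp A) := by
  rw [traceCLM_apply, traceCLM_apply, ContinuousLinearMap.toLinearMap_comp,
    ContinuousLinearMap.toLinearMap_comp]
  exact LinearMap.trace_mul_comm ℝ _ _

theorem traceCLM_continuousK (ω : E6 [⋀^Fin 2]→L[ℝ] ℝ) (φ : E6 [⋀^Fin 3]→L[ℝ] ℝ) :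
    traceCLM (continuousK ω φ) = 0 := by
  have h : (continuousK ω φ : E6 →ₗ[ℝ] E6) = K stdBasis ω.toAlternatingMap φ.toAlternatingMap := by
    ext1 v
    rfl
  rw [traceCLM_apply, h, K_eq_endo, trace_endo]

theorem Q_eq_traceCLM (ω : E6 [⋀^Fin 2]→L[ℝ] ℝ) (φ : E6 [⋀^Fin 3]→L[ℝ] ℝ) :
    Q stdBasis ω.toAlternatingMap φ.toAlternatingMap =
      2 / 3 * traceCLM ((continuousK ω φ).comp (continuousK ω φ)) := by
  have h : (continuousK ω φ : E6 →ₗ[ℝ] E6) = K stdBasis ω.toAlternatingMap φ.toAlternatingMap := by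
    ext1 v
    rfl
  rw [Q_eq_trace, traceCLM_apply, ContinuousLinearMap.toLinearMap_comp, h]

/-- Trace of X ↦ N(X, Y): the terms A ∘ A'(·)Y and (A'(·)Y) ∘ A have equal traces and cancel, and
A'(AY) is traceless by `htr`. -/
theorem traceCLM_comp_eq_zero {A : E6 →L[ℝ] E6} {A' : E6 →L[ℝ] E6 →L[ℝ] E6}
    (hN : ∀ X Y, nijenhuisTensor A A' X Y = 0) (htr : ∀ u, traceCLM (A' u) = 0) (Y : E6) :
    traceCLM (A.comp (A' Y)) = 0 := by
  have h1 : A.comp (A'.flip Y) - A.comp (A' Y) - (A'.flip Y).comp A + A' (A Y) = 0 := by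
    ext1 X
    simpa [nijenhuisTensor] using hN X Y
  have h2 := congrArg traceCLM h1
  rw [map_add, map_sub, map_sub, htr, traceCLM_comp_comm A (A'.flip Y), map_zero] at h2
  linarith

theorem hasFDerivAt_Q (hW : DifferentiableAt ℝ W y) (hΦ : DifferentiableAt ℝ Φ y)
    (h : liouville (W y).toAlternatingMap ≠ 0) (hA : extDeriv Φ y = 0)
    (hB : extDeriv (fun z => continuousF (W z) (Φ z)) y = 0) :
    HasFDerivAt (fun z => Q stdBasis (W z).toAlternatingMap (Φ z).toAlternatingMap)
      (0 : E6 →L[ℝ] ℝ) y := by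
  have hK := (differentiableAt_continuousK hW hΦ h).hasFDerivAt
  set A := continuousK (W y) (Φ y) with hAdef
  set A' := fderiv ℝ (fun z => continuousK (W z) (Φ z)) y with hA'def
  have htr : ∀ u, traceCLM (A' u) = 0 := fun u => by
    have h1 := traceCLM.hasFDerivAt.comp y hK
    have h2 : (traceCLM ∘ fun z => continuousK (W z) (Φ z)) = fun _ => (0 : ℝ) :=
      funext fun z => traceCLM_continuousK _ _
    rw [h2] at h1
    have h3 := h1.unique (hasFDerivAt_const (0 : ℝ) y)
    exact DFunLike.congr_fun h3 u
  have hN := traceCLM_comp_eq_zero (nijenhuisTensor_eq_zero hW hΦ h hA hB) htr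
  have h1 := ((traceCLM.hasFDerivAt.comp y (hK.clm_comp hK)).const_mul (2 / 3 : ℝ))
  have h2 : (fun z => Q stdBasis (W z).toAlternatingMap (Φ z).toAlternatingMap) = fun z => 2 / 3 *
      (traceCLM ∘ fun z => (continuousK (W z) (Φ z)).comp (continuousK (W z) (Φ z))) z :=
    funext fun z => Q_eq_traceCLM _ _
  rw [h2]
  refine h1.congr_fderiv ?_
  ext1 Y
  have h3 : traceCLM (A.comp (A' Y)) + traceCLM ((A' Y).comp A) = 0 := by
    rw [traceCLM_comp_comm (A' Y), hN, add_zero]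
  rw [hAdef] at h3
  simp
  linarith

/-- Tensoriality: all terms with derivatives of X and Y cancel, so the pointwise tensor computes the
bracket expression. -/
theorem nijenhuis_bracket_eq (A : E6 → E6 →L[ℝ] E6) (hA : DifferentiableAt ℝ A y) {X Y : E6 → E6}
    (hX : DifferentiableAt ℝ X y) (hY : DifferentiableAt ℝ Y y) :
    -A y (A y (VectorField.lieBracket ℝ X Y y))
      + A y (VectorField.lieBracket ℝ (fun z => A z (X z)) Y y
        + VectorField.lieBracket ℝ X (fun z => A z (Y z)) y)
      - VectorField.lieBracket ℝ (fun z => A z (X z)) (fun z => A z (Y z)) y =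
    nijenhuisTensor (A y) (fderiv ℝ A y) (X y) (Y y) := by
  have h1 := (hA.hasFDerivAt.clm_apply hX.hasFDerivAt).fderiv
  have h2 := (hA.hasFDerivAt.clm_apply hY.hasFDerivAt).fderiv
  simp only [VectorField.lieBracket, h1, h2, nijenhuisTensor]
  simp
  abel

end FlatConsequences

/-! ### Naturality under charts, and constancy of Q on M -/

section Transport
variable {M : Type*} [TopologicalSpace M] [ChartedSpace E6 M]

theorem toAlternatingMap_compContinuousLinearMap {k : ℕ} (g : E6 ≃L[ℝ] E6)
    (α : E6 [⋀^Fin k]→L[ℝ] ℝ) :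
    (α.compContinuousLinearMap (g : E6 →L[ℝ] E6)).toAlternatingMap =
      α.toAlternatingMap.compLinearMap g.toLinearEquiv.toLinearMap := by
  ext v
  rfl

theorem K_pullback (g : E6 ≃L[ℝ] E6) (ω : E6 [⋀^Fin 2]→L[ℝ] ℝ) (φ : E6 [⋀^Fin 3]→L[ℝ] ℝ)
    (h : liouville ω.toAlternatingMap ≠ 0) (v : E6) :
    g (K stdBasis (ω.compContinuousLinearMap (g : E6 →L[ℝ] E6)).toAlternatingMap
      (φ.compContinuousLinearMap (g : E6 →L[ℝ] E6)).toAlternatingMap v) =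
      K stdBasis ω.toAlternatingMap φ.toAlternatingMap (g v) := by
  have h1 := endo_compLinearMap stdBasis (liouville ω.toAlternatingMap) φ.toAlternatingMap
    φ.toAlternatingMap g.toLinearEquiv v
  -- Naturality yields K in the image of the standard basis; independence of the basis, which needs
  -- ω³ ≠ 0, returns to the standard one.
  rw [endo_eq (stdBasis.map g.toLinearEquiv) stdBasis h, ← liouville_compLinearMap] at h1
  rw [toAlternatingMap_compContinuousLinearMap]
  rw [toAlternatingMap_compContinuousLinearMap]
  rw [K_eq_endo, K_eq_endo]
  simpa only [ContinuousLinearEquiv.coe_toLinearEquiv] using h1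

theorem liouville_pullback_ne_zero (g : E6 ≃L[ℝ] E6) (ω : E6 [⋀^Fin 2]→L[ℝ] ℝ)
    (h : liouville ω.toAlternatingMap ≠ 0) :
    liouville (ω.compContinuousLinearMap (g : E6 →L[ℝ] E6)).toAlternatingMap ≠ 0 := by
  rw [toAlternatingMap_compContinuousLinearMap, liouville_compLinearMap]
  intro h0
  apply h
  ext v
  have h2 := DFunLike.congr_fun h0 fun i => g.symm (v i)
  have hv : (fun i => g.toLinearEquiv.toLinearMap (g.symm (v i))) = v := by
    ext1 i
    exact g.apply_symm_apply _
  rw [AlternatingMap.compLinearMap_apply] at h2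
  rw [hv] at h2
  exact h2

theorem continuousF_pullback (g : E6 ≃L[ℝ] E6) (ω : E6 [⋀^Fin 2]→L[ℝ] ℝ)
    (φ : E6 [⋀^Fin 3]→L[ℝ] ℝ) (h : liouville ω.toAlternatingMap ≠ 0) :
    (continuousF ω φ).compContinuousLinearMap (g : E6 →L[ℝ] E6) =
      continuousF (ω.compContinuousLinearMap (g : E6 →L[ℝ] E6))
        (φ.compContinuousLinearMap (g : E6 →L[ℝ] E6)) := by
  ext v
  rw [ContinuousAlternatingMap.compContinuousLinearMap_apply, continuousF_apply, continuousF_apply,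
    ContinuousAlternatingMap.compContinuousLinearMap_apply]
  have e : ∀ a b c, ⇑(g : E6 →L[ℝ] E6) ∘ ![a, b, c] = ![g a, g b, g c] := fun a b c => by
    ext1 i
    fin_cases i <;> rfl
  rw [e, K_pullback g ω φ h]
  simp only [Function.comp_apply, ContinuousLinearEquiv.coe_coe]

/-- The endomorphism of the pulled-back forms is g⁻¹Kg, and Q is a trace. -/
theorem Q_pullback (g : E6 ≃L[ℝ] E6) (ω : E6 [⋀^Fin 2]→L[ℝ] ℝ) (φ : E6 [⋀^Fin 3]→L[ℝ] ℝ)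
    (h : liouville ω.toAlternatingMap ≠ 0) :
    Q stdBasis (ω.compContinuousLinearMap (g : E6 →L[ℝ] E6)).toAlternatingMap
      (φ.compContinuousLinearMap (g : E6 →L[ℝ] E6)).toAlternatingMap =
      Q stdBasis ω.toAlternatingMap φ.toAlternatingMap := by
  rw [Q_eq_trace, Q_eq_trace]
  set A := K stdBasis ω.toAlternatingMap φ.toAlternatingMap with hA
  have h1 : K stdBasis (ω.compContinuousLinearMap (g : E6 →L[ℝ] E6)).toAlternatingMap
      (φ.compContinuousLinearMap (g : E6 →L[ℝ] E6)).toAlternatingMap =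
      g.symm.toLinearEquiv.conj A := by
    ext1 v
    apply g.injective
    rw [K_pullback g ω φ h, LinearEquiv.conj_apply]
    simp [hA]
  rw [h1, ← LinearEquiv.conj_comp, LinearMap.trace_conj']

variable {ω : DiffForm M 2} {φ : DiffForm M 3}

theorem IsSymplectic.liouville_ne_zero (hω : IsSymplectic ω) (x : M) :
    liouville (ω x).toAlternatingMap ≠ 0 :=
  ThreeForm.liouville_ne_zero stdBasis _ (hω.nondegenerate x)

/-- The pullback of a form on `E6` through the derivative of the inverse chart. -/
theorem chartForm_eq {k : ℕ} (α : DiffForm M k) {x : M} {y : E6} {g : E6 ≃L[ℝ] E6}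
    (hg : ∀ v : E6, g v =
      (mfderiv 𝓘(ℝ, E6) (𝓡 6) (extChartAt (𝓡 6) x).symm y : E6 →L[ℝ] E6) v) :
    chartForm α x y = ContinuousAlternatingMap.compContinuousLinearMap
      (α ((extChartAt (𝓡 6) x).symm y) : E6 [⋀^Fin k]→L[ℝ] ℝ) (g : E6 →L[ℝ] E6) := by
  have : (g : E6 →L[ℝ] E6) = mfderiv 𝓘(ℝ, E6) (𝓡 6) (extChartAt (𝓡 6) x).symm y := by
    ext1 v
    exact hg v
  rw [this]
  rfl

theorem IsSmoothForm.differentiableAt {k : ℕ} {α : DiffForm M k} (hα : IsSmoothForm α) {x : M}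
    {y : E6} (hy : y ∈ (extChartAt (𝓡 6) x).target) : DifferentiableAt ℝ (chartForm α x) y :=
  ((hα x).contDiffAt ((isOpen_extChartAt_target x).mem_nhds hy)).differentiableAt (by simp)

variable [IsManifold (𝓡 6) ((⊤ : ℕ∞) : WithTop ℕ∞) M]

theorem exists_chart_equiv {x : M} {y : E6} (hy : y ∈ (extChartAt (𝓡 6) x).target) :
    ∃ g : E6 ≃L[ℝ] E6, ∀ v : E6, g v =
      (mfderiv 𝓘(ℝ, E6) (𝓡 6) (extChartAt (𝓡 6) x).symm y : E6 →L[ℝ] E6) v := by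
  have : IsManifold (𝓡 6) 1 M := IsManifold.of_le (n := ((⊤ : ℕ∞) : WithTop ℕ∞)) (by norm_num)
  obtain ⟨g, hg⟩ := isInvertible_mfderivWithin_extChartAt_symm (I := 𝓡 6) hy
  refine ⟨g, fun v => ?_⟩
  rw [ModelWithCorners.Boundaryless.range_eq_univ, mfderivWithin_univ] at hg
  exact DFunLike.congr_fun hg v

theorem liouville_chartForm_ne_zero (hω : IsSymplectic ω) {x : M} {y : E6}
    (hy : y ∈ (extChartAt (𝓡 6) x).target) :
    liouville (chartForm ω x y).toAlternatingMap ≠ 0 := by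
  obtain ⟨g, hg⟩ := exists_chart_equiv hy
  rw [chartForm_eq ω hg]
  exact liouville_pullback_ne_zero g _ (hω.liouville_ne_zero _)

theorem chartForm_formF (hω : IsSymplectic ω) {x : M} {y : E6}
    (hy : y ∈ (extChartAt (𝓡 6) x).target) :
    chartForm (formF ω φ) x y = continuousF (chartForm ω x y) (chartForm φ x y) := by
  obtain ⟨g, hg⟩ := exists_chart_equiv hy
  rw [chartForm_eq _ hg, chartForm_eq ω hg, chartForm_eq φ hg]
  exact continuousF_pullback g _ _ (hω.liouville_ne_zero _)

theorem Q_chartForm (hω : IsSymplectic ω) {x : M} {y : E6}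
    (hy : y ∈ (extChartAt (𝓡 6) x).target) :
    Q stdBasis (chartForm ω x y).toAlternatingMap (chartForm φ x y).toAlternatingMap =
      functionQ ω φ ((extChartAt (𝓡 6) x).symm y) := by
  obtain ⟨g, hg⟩ := exists_chart_equiv hy
  rw [chartForm_eq ω hg, chartForm_eq φ hg]
  exact Q_pullback g _ _ (hω.liouville_ne_zero _)

theorem extDeriv_chartForm {k : ℕ} {α : DiffForm M k} {x : M} (h : extDerivForm α x = 0) :
    extDeriv (chartForm α x) (extChartAt (𝓡 6) x x) = 0 := by
  have : IsManifold (𝓡 6) 1 M := IsManifold.of_le (n := ((⊤ : ℕ∞) : WithTop ℕ∞)) (by norm_num)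
  rw [extDerivForm, mfderiv_extChartAt_self] at h
  exact h

theorem extDeriv_chartForm_F (hω : IsSymplectic ω) {x : M}
    (h : extDerivForm (formF ω φ) x = 0) :
    extDeriv (fun z => continuousF (chartForm ω x z) (chartForm φ x z))
      (extChartAt (𝓡 6) x x) = 0 := by
  rw [← extDeriv_chartForm h]
  refine Filter.EventuallyEq.extDeriv_eq ?_
  filter_upwards [extChartAt_target_mem_nhds (I := 𝓡 6) x] with y hy
  exact (chartForm_formF hω hy).symm

/-- `extDerivForm` at x is computed in the chart at x, so the hypotheses are used only at the centre
of each chart. The result dQ = 0 is intrinsic and can then be read in any other chart. -/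
theorem hasMFDerivAt_functionQ (hω : IsSymplectic ω) (hφ : IsSmoothForm φ)
    (hd : IsIntegrable φ) (hF : IsFIntegrable ω φ) (x : M) :
    HasMFDerivAt (𝓡 6) 𝓘(ℝ, ℝ) (functionQ ω φ) x (0 : E6 →L[ℝ] ℝ) := by
  have ht := extChartAt_target_mem_nhds (I := 𝓡 6) x
  have hx := mem_extChartAt_target (I := 𝓡 6) x
  have h1 := hasFDerivAt_Q (hω.smooth.differentiableAt hx) (hφ.differentiableAt hx)
    (liouville_chartForm_ne_zero hω hx) (extDeriv_chartForm (hd x)) (extDeriv_chartForm_F hω (hF x))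
  have h2 : HasFDerivAt (functionQ ω φ ∘ (extChartAt (𝓡 6) x).symm) (0 : E6 →L[ℝ] ℝ)
      (extChartAt (𝓡 6) x x) := by
    refine h1.congr_of_eventuallyEq ?_
    filter_upwards [ht] with y hy
    exact (Q_chartForm hω hy).symm
  constructor
  · have h3 := h2.continuousAt.comp (continuousAt_extChartAt (I := 𝓡 6) x)
    refine h3.congr ?_
    filter_upwards [extChartAt_source_mem_nhds (I := 𝓡 6) x] with z hz
    simp only [Function.comp_apply, (extChartAt (𝓡 6) x).left_inv hz]
  · exact h2.hasFDerivWithinAt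

theorem isQIntegrable [ConnectedSpace M] (hω : IsSymplectic ω) (hφ : IsSmoothForm φ)
    (hd : IsIntegrable φ) (hF : IsFIntegrable ω φ) : IsQIntegrable ω φ := by
  have hloc : IsLocallyConstant (functionQ ω φ) := by
    rw [IsLocallyConstant.iff_eventually_eq]
    intro x
    have ht := extChartAt_target_mem_nhds (I := 𝓡 6) x
    obtain ⟨r, hr, hball⟩ := Metric.mem_nhds_iff.mp ht
    have h1 : ∀ y ∈ Metric.ball (extChartAt (𝓡 6) x x) r,
        HasFDerivAt (functionQ ω φ ∘ (extChartAt (𝓡 6) x).symm) (0 : E6 →L[ℝ] ℝ) y := by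
      intro y hy
      have h2 : MDifferentiableAt 𝓘(ℝ, E6) (𝓡 6) (extChartAt (𝓡 6) x).symm y :=
        ((contMDiffOn_extChartAt_symm (I := 𝓡 6) (n := ((⊤ : ℕ∞) : WithTop ℕ∞)) x).contMDiffAt
          ((isOpen_extChartAt_target x).mem_nhds (hball hy))).mdifferentiableAt (by simp)
      -- The vanishing of dQ at the point over y comes from that point's own chart and passes to the
      -- chart at x by the chain rule.
      have h3 := (hasMFDerivAt_functionQ hω hφ hd hF ((extChartAt (𝓡 6) x).symm y)).comp y
        h2.hasMFDerivAt
      have h4 := h3.hasFDerivAt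
      refine h4.congr_fderiv ?_
      exact ContinuousLinearMap.zero_comp _
    have h2 : ∀ y ∈ Metric.ball (extChartAt (𝓡 6) x x) r,
        functionQ ω φ ((extChartAt (𝓡 6) x).symm y) =
          functionQ ω φ ((extChartAt (𝓡 6) x).symm (extChartAt (𝓡 6) x x)) := fun y hy =>
      Metric.isOpen_ball.is_const_of_fderiv_eq_zero (𝕜 := ℝ)
        (f := functionQ ω φ ∘ (extChartAt (𝓡 6) x).symm) (convex_ball _ _).isPreconnected
        (fun z hz => (h1 z hz).differentiableAt.differentiableWithinAt)
        (fun z hz => (h1 z hz).fderiv) hy (Metric.mem_ball_self hr)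
    filter_upwards [extChartAt_source_mem_nhds (I := 𝓡 6) x,
      (continuousAt_extChartAt (I := 𝓡 6) x).preimage_mem_nhds (Metric.ball_mem_nhds _ hr)]
      with z hz hzb
    have h3 := h2 _ hzb
    rwa [(extChartAt (𝓡 6) x).left_inv hz, extChartAt_to_inv] at h3
  obtain ⟨x⟩ := (inferInstance : Nonempty M)
  exact ⟨functionQ ω φ x, fun z => hloc.apply_eq_of_preconnectedSpace z x⟩

end Transport

/-! ### The Nijenhuis tensor on M -/

section Nijenhuis
variable {M : Type*} [TopologicalSpace M] [ChartedSpace E6 M]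
  [IsManifold (𝓡 6) ((⊤ : ℕ∞) : WithTop ℕ∞) M]
  {ω : DiffForm M 2} {φ : DiffForm M 3}

/-- The tangent space at x is identified with ℝ⁶ through the preferred chart at x, so no Jacobian
appears at the centre of that chart. -/
theorem mfderiv_extChartAt_symm_self (x : M) (v : E6) :
    (mfderiv 𝓘(ℝ, E6) (𝓡 6) (extChartAt (𝓡 6) x).symm (extChartAt (𝓡 6) x x) : E6 →L[ℝ] E6) v
      = v := by
  have : IsManifold (𝓡 6) 1 M := IsManifold.of_le (n := ((⊤ : ℕ∞) : WithTop ℕ∞)) (by norm_num)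
  have h := mfderivWithin_range_extChartAt_symm (I := 𝓡 6) (x := x)
  rw [ModelWithCorners.Boundaryless.range_eq_univ, mfderivWithin_univ] at h
  exact DFunLike.congr_fun h v

theorem chartForm_self {k : ℕ} (α : DiffForm M k) (x : M) :
    chartForm α x (extChartAt (𝓡 6) x x) = (α x : E6 [⋀^Fin k]→L[ℝ] ℝ) := by
  have h : ∀ z : M, z = x → (α z : E6 [⋀^Fin k]→L[ℝ] ℝ) = (α x : E6 [⋀^Fin k]→L[ℝ] ℝ) := by
    rintro z rfl
    rfl
  rw [chartForm_eq α (g := ContinuousLinearEquiv.refl ℝ E6)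
    fun v => (mfderiv_extChartAt_symm_self x v).symm]
  exact h _ (extChartAt_to_inv (I := 𝓡 6) x)

set_option maxRecDepth 20000 in
theorem continuousK_chartForm_self (x : M) (v : E6) :
    continuousK (chartForm ω x (extChartAt (𝓡 6) x x)) (chartForm φ x (extChartAt (𝓡 6) x x)) v =
      fieldK ω φ x v := by
  rw [chartForm_self, chartForm_self]
  exact continuousK_apply (ω x) (φ x) v

theorem inverse_apply_of_eq {T : E6 →L[ℝ] E6} {g : E6 ≃L[ℝ] E6} (h : (g : E6 →L[ℝ] E6) = T)
    (v : E6) : T.inverse v = g.symm v := by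
  rw [← h, ContinuousLinearMap.inverse_equiv]
  rfl

theorem symm_K_apply (g : E6 ≃L[ℝ] E6) (ω : E6 [⋀^Fin 2]→L[ℝ] ℝ) (φ : E6 [⋀^Fin 3]→L[ℝ] ℝ)
    (h : liouville ω.toAlternatingMap ≠ 0) (v : E6) :
    g.symm (K stdBasis ω.toAlternatingMap φ.toAlternatingMap v) =
      continuousK (ω.compContinuousLinearMap (g : E6 →L[ℝ] E6))
        (φ.compContinuousLinearMap (g : E6 →L[ℝ] E6)) (g.symm v) := by
  rw [ContinuousLinearEquiv.symm_apply_eq, continuousK_apply, K_pullback g ω φ h,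
    ContinuousLinearEquiv.apply_symm_apply]

/-- A vector field in the preferred chart at `x`. -/
noncomputable def chartField (X : ∀ x : M, TangentSpace (𝓡 6) x) (x : M) : E6 → E6 :=
  VectorField.mpullbackWithin 𝓘(ℝ, E6) (𝓡 6) (extChartAt (𝓡 6) x).symm X (Set.range (𝓡 6))

omit [IsManifold (𝓡 6) ((⊤ : ℕ∞) : WithTop ℕ∞) M] in
theorem chartField_eq (X : ∀ x : M, TangentSpace (𝓡 6) x) {x : M} {y : E6} {g : E6 ≃L[ℝ] E6}
    (hg : ∀ v : E6, g v =
      (mfderiv 𝓘(ℝ, E6) (𝓡 6) (extChartAt (𝓡 6) x).symm y : E6 →L[ℝ] E6) v) :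
    chartField X x y = g.symm (X ((extChartAt (𝓡 6) x).symm y)) := by
  have h : (g : E6 →L[ℝ] E6) = mfderiv 𝓘(ℝ, E6) (𝓡 6) (extChartAt (𝓡 6) x).symm y := by
    ext1 v
    exact hg v
  have h2 : chartField X x y = (mfderiv 𝓘(ℝ, E6) (𝓡 6) (extChartAt (𝓡 6) x).symm y :
      E6 →L[ℝ] E6).inverse (X ((extChartAt (𝓡 6) x).symm y) : E6) := by
    rw [chartField, VectorField.mpullbackWithin_apply, ModelWithCorners.Boundaryless.range_eq_univ,
      mfderivWithin_univ]
  exact h2.trans (inverse_apply_of_eq h _)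

set_option maxRecDepth 20000 in
theorem chartField_fieldK (hω : IsSymplectic ω) (X : ∀ x : M, TangentSpace (𝓡 6) x) {x : M} {y : E6}
    (hy : y ∈ (extChartAt (𝓡 6) x).target) :
    chartField (fun z => fieldK ω φ z (X z)) x y =
      continuousK (chartForm ω x y) (chartForm φ x y) (chartField X x y) := by
  obtain ⟨g, hg⟩ := exists_chart_equiv hy
  rw [chartField_eq _ hg, chartField_eq _ hg, chartForm_eq ω hg, chartForm_eq φ hg]
  exact symm_K_apply g _ _ (hω.liouville_ne_zero _) _

theorem differentiableAt_chartField [IsManifold (𝓡 6) 1 M] {X : ∀ x : M, TangentSpace (𝓡 6) x}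
    (hX : IsSmoothField X) (x : M) :
    DifferentiableAt ℝ (chartField X x) (extChartAt (𝓡 6) x x) := by
  have : IsManifold (𝓡 6) 2 M := IsManifold.of_le (n := ((⊤ : ℕ∞) : WithTop ℕ∞)) (by norm_cast)
  have h1 : MDifferentiableWithinAt (𝓡 6) (𝓡 6).tangent
      (fun z => (⟨z, X z⟩ : TangentBundle (𝓡 6) M)) Set.univ x :=
    (hX.contMDiffAt.mdifferentiableAt (by simp)).mdifferentiableWithinAt
  have h2 : DifferentiableWithinAt ℝ (chartField X x)
      ((extChartAt (𝓡 6) x).symm ⁻¹' Set.univ ∩ Set.range (𝓡 6)) (extChartAt (𝓡 6) x x) :=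
    h1.differentiableWithinAt_mpullbackWithin_vectorField
  refine h2.differentiableAt ?_
  rw [Set.preimage_univ, Set.univ_inter, ModelWithCorners.Boundaryless.range_eq_univ]
  exact Filter.univ_mem

theorem mlieBracket_eq_chartField (X Y : ∀ x : M, TangentSpace (𝓡 6) x) (x : M) :
    VectorField.mlieBracket (𝓡 6) X Y x =
      VectorField.lieBracket ℝ (chartField X x) (chartField Y x) (extChartAt (𝓡 6) x x) := by
  have : IsManifold (𝓡 6) 1 M := IsManifold.of_le (n := ((⊤ : ℕ∞) : WithTop ℕ∞)) (by norm_num)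
  rw [VectorField.mlieBracket, VectorField.mlieBracketWithin_apply]
  have h : ∀ s : Set E6, s = Set.univ → VectorField.lieBracketWithin ℝ (chartField X x)
      (chartField Y x) s (extChartAt (𝓡 6) x x) =
      VectorField.lieBracket ℝ (chartField X x) (chartField Y x) (extChartAt (𝓡 6) x x) := by
    rintro s rfl
    rw [VectorField.lieBracketWithin_univ]
  have hid : (ContinuousLinearEquiv.refl ℝ E6 : E6 →L[ℝ] E6) =
      mfderiv (𝓡 6) 𝓘(ℝ, E6) (extChartAt (𝓡 6) x) x :=
    (mfderiv_extChartAt_self (I := 𝓡 6) (x := x)).symm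
  refine (inverse_apply_of_eq hid _).trans (h _ ?_)
  rw [Set.preimage_univ, Set.univ_inter, ModelWithCorners.Boundaryless.range_eq_univ]

-- The brackets on M at x are brackets of the fields read in the chart at x, where K becomes the K
-- of the chart forms; the flat result applies at the centre.
set_option maxRecDepth 20000 in
theorem isKIntegrable [IsManifold (𝓡 6) 1 M] (hω : IsSymplectic ω) (hφ : IsSmoothForm φ)
    (hd : IsIntegrable φ) (hF : IsFIntegrable ω φ) : IsKIntegrable ω φ := by
  intro X Y hX hY x
  have hx := mem_extChartAt_target (I := 𝓡 6) x
  have hW := hω.smooth.differentiableAt hx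
  have hΦ := hφ.differentiableAt hx
  have hl := liouville_chartForm_ne_zero hω hx
  have hK := differentiableAt_continuousK hW hΦ hl
  have hev : ∀ X : ∀ x : M, TangentSpace (𝓡 6) x,
      chartField (fun z => fieldK ω φ z (X z)) x =ᶠ[nhds (extChartAt (𝓡 6) x x)] fun y =>
        continuousK (chartForm ω x y) (chartForm φ x y) (chartField X x y) := fun X => by
    filter_upwards [extChartAt_target_mem_nhds (I := 𝓡 6) x] with y hy
    exact chartField_fieldK hω X hy
  have h1 := nijenhuis_bracket_eq (fun y => continuousK (chartForm ω x y) (chartForm φ x y)) hK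
    (differentiableAt_chartField hX x) (differentiableAt_chartField hY x)
  rw [nijenhuisTensor_eq_zero hW hΦ hl (extDeriv_chartForm (hd x))
    (extDeriv_chartForm_F hω (hF x))] at h1
  obtain ⟨L, hL⟩ : ∃ L : E6 → E6, L = fun v => fieldK ω φ x v := ⟨_, rfl⟩
  have hKL : ∀ v, continuousK (chartForm ω x (extChartAt (𝓡 6) x x))
      (chartForm φ x (extChartAt (𝓡 6) x x)) v = L v := fun v =>
    (continuousK_chartForm_self x v).trans (congrFun hL v).symm
  simp only [hKL] at h1
  rw [nijenhuis, mlieBracket_eq_chartField, mlieBracket_eq_chartField, mlieBracket_eq_chartField,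
    mlieBracket_eq_chartField, (hev X).lieBracket_vectorField_eq Filter.EventuallyEq.rfl,
    Filter.EventuallyEq.rfl.lieBracket_vectorField_eq (hev Y),
    (hev X).lieBracket_vectorField_eq (hev Y)]
  rw [hL] at h1
  exact h1

end Nijenhuis

/-! ### The infinitesimal action of endomorphisms on 3-forms -/

section Derivation
variable {V : Type*} [AddCommGroup V] [Module ℝ V]

theorem apply_sum_first (a : V [⋀^Fin 3]→ₗ[ℝ] ℝ) (c : Fin 6 → ℝ) (w : Fin 6 → V) (y z : V) :
    a ![∑ e, c e • w e, y, z] = ∑ e, c e * a ![w e, y, z] := by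
  have hc : ∀ x y z, a ![x, y, z] = a.curryLeft x ![y, z] := fun _ _ _ => rfl
  simp only [hc, map_sum, map_smul, sum_alternating_apply, AlternatingMap.smul_apply, smul_eq_mul]

theorem apply_sum_second (a : V [⋀^Fin 3]→ₗ[ℝ] ℝ) (c : Fin 6 → ℝ) (w : Fin 6 → V) (x z : V) :
    a ![x, ∑ e, c e • w e, z] = ∑ e, c e * a ![x, w e, z] := by
  simp only [apply_swap_left a _ x z, apply_sum_first, mul_neg, Finset.sum_neg_distrib]

theorem apply_sum_third (a : V [⋀^Fin 3]→ₗ[ℝ] ℝ) (c : Fin 6 → ℝ) (w : Fin 6 → V) (x y : V) :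
    a ![x, y, ∑ e, c e • w e] = ∑ e, c e * a ![x, y, w e] := by
  simp only [apply_swap_right a x _ y, apply_sum_second, mul_neg, Finset.sum_neg_distrib]

theorem apply_smul_first (a : V [⋀^Fin 3]→ₗ[ℝ] ℝ) (c : ℝ) (x y z : V) :
    a ![c • x, y, z] = c * a ![x, y, z] := by
  have hc : ∀ x y z, a ![x, y, z] = a.curryLeft x ![y, z] := fun _ _ _ => rfl
  simp only [hc, map_smul, AlternatingMap.smul_apply, smul_eq_mul]

theorem apply_smul_second (a : V [⋀^Fin 3]→ₗ[ℝ] ℝ) (c : ℝ) (x y z : V) :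
    a ![x, c • y, z] = c * a ![x, y, z] := by
  rw [apply_swap_left, apply_smul_first, apply_swap_left a x y]
  ring

theorem apply_smul_third (a : V [⋀^Fin 3]→ₗ[ℝ] ℝ) (c : ℝ) (x y z : V) :
    a ![x, y, c • z] = c * a ![x, y, z] := by
  rw [apply_swap_right, apply_smul_second, apply_swap_right a x y]
  ring

/-- The infinitesimal action of an endomorphism on a 3-form, evaluated on three vectors. -/
def derivAction (φ : V [⋀^Fin 3]→ₗ[ℝ] ℝ) (A : V →ₗ[ℝ] V) (x y z : V) : ℝ :=
  φ ![A x, y, z] + φ ![x, A y, z] + φ ![x, y, A z]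

/-- Independence of x, y, z allows them to be the first three vectors of a basis, where the claim is
`polarK_derivation`. -/
theorem derivAction_endo (b : Module.Basis (Fin 6) ℝ V) {τ : V [⋀^Fin 6]→ₗ[ℝ] ℝ} (hτ : τ ≠ 0)
    (φ χ : V [⋀^Fin 3]→ₗ[ℝ] ℝ) {x y z : V} (h : LinearIndependent ℝ ![x, y, z]) :
    derivAction φ (endo b τ φ χ + endo b τ χ φ) x y z =
      2 * derivAction χ (endo b τ φ φ) x y z -
        3 * ((τ b)⁻¹ * wedge (n := 6) rfl φ χ b) * φ ![x, y, z] := by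
  obtain ⟨b', rfl, rfl, rfl⟩ := exists_basis_of_linearIndependent_three b h
  -- The ratio of two 6-forms does not depend on the basis.
  have hw : (τ b)⁻¹ * wedge (n := 6) rfl φ χ b = (τ b')⁻¹ * wedge (n := 6) rfl φ χ b' := by
    have h1 := congrArg (fun a => a b') (τ.eq_smul_basis_det b)
    have h2 := congrArg (fun a => a b') ((wedge (n := 6) rfl φ χ).eq_smul_basis_det b)
    simp only [AlternatingMap.smul_apply, smul_eq_mul] at h1 h2
    have h3 := apply_basis_ne_zero b τ hτ
    have h4 := apply_basis_ne_zero b' τ hτ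
    rw [inv_mul_eq_div, inv_mul_eq_div, div_eq_div_iff h3 h4, h1, h2]
    ring
  have key := polarK_derivation (isAlt_comp b' φ) (isAlt_comp b' χ)
  have hL : ∀ j, (endo b' τ φ χ + endo b' τ χ φ) (b' j) = ∑ i, ((τ b')⁻¹ *
      (polarK (comp b' φ) (comp b' χ) i j + polarK (comp b' χ) (comp b' φ) i j)) • b' i := by
    intro j
    rw [LinearMap.add_apply, endo_basis, endo_basis, ← Finset.sum_add_distrib]
    exact Finset.sum_congr rfl fun i _ => by rw [← add_smul]; ring_nf
  rw [hw, endo_eq b b' hτ, endo_eq b b' hτ, endo_eq b b' hτ, derivAction, derivAction, hL, hL, hL,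
    endo_basis, endo_basis, endo_basis]
  simp only [apply_sum_first, apply_sum_second, apply_sum_third, wedge_three_three]
  have hc : ∀ (a : V [⋀^Fin 3]→ₗ[ℝ] ℝ) i j k, a ![b' i, b' j, b' k] = comp b' a i j k :=
    fun _ _ _ _ => rfl
  simp only [hc, mul_assoc, ← Finset.mul_sum]
  simp only [Finset.sum_add_distrib] at key ⊢
  linear_combination (τ b')⁻¹ * key

end Derivation

/-! ### Nonzero Q implies stability -/

section Stable

/-- The derivative at the identity of the orbit map of a 3-form. -/
theorem fderivCompContinuousLinearMap_id (φ : E6 [⋀^Fin 3]→L[ℝ] ℝ) (A : E6 →L[ℝ] E6)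
    (v : Fin 3 → E6) :
    φ.fderivCompContinuousLinearMap (ContinuousLinearMap.id ℝ E6) A v =
      derivAction φ.toAlternatingMap A.toLinearMap (v 0) (v 1) (v 2) := by
  rw [ContinuousAlternatingMap.fderivCompContinuousLinearMap_apply, Fin.sum_univ_three, derivAction]
  congr 1
  congr 1
  all_goals
    refine congrArg φ ?_
    ext1 j
    fin_cases j <;> rfl

/-- This places K·χ, for every χ, in the tangent space of the orbit of φ. -/
theorem exists_fderiv_eq_derivAction {τ : E6 [⋀^Fin 6]→ₗ[ℝ] ℝ} (hτ : τ ≠ 0)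
    (φ χ : E6 [⋀^Fin 3]→L[ℝ] ℝ) :
    ∃ A : E6 →L[ℝ] E6, φ.fderivCompContinuousLinearMap (ContinuousLinearMap.id ℝ E6) A =
      χ.fderivCompContinuousLinearMap (ContinuousLinearMap.id ℝ E6)
        (endo stdBasis τ φ.toAlternatingMap φ.toAlternatingMap).toContinuousLinearMap := by
  set c := (τ stdBasis)⁻¹ *
    wedge (n := 6) rfl φ.toAlternatingMap χ.toAlternatingMap stdBasis with hc
  set L := endo stdBasis τ φ.toAlternatingMap χ.toAlternatingMap +
    endo stdBasis τ χ.toAlternatingMap φ.toAlternatingMap with hL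
  -- A = L/2 + (c/2)·1: the identity acts on 3-forms as multiplication by 3, so its term cancels the
  -- -3cφ of `derivAction_endo`. The zeros pad A x to a six-term sum, the format of
  -- `apply_sum_first` and its companions.
  obtain ⟨A, hA⟩ : ∃ A : E6 →ₗ[ℝ] E6, ∀ x, A x =
      ∑ i : Fin 6, (![1 / 2, c / 2, 0, 0, 0, 0] : Fin 6 → ℝ) i •
        (![L x, x, 0, 0, 0, 0] : Fin 6 → E6) i := by
    refine ⟨(1 / 2 : ℝ) • L + (c / 2) • LinearMap.id, fun x => ?_⟩
    simp only [Fin.sum_univ_six, Matrix.cons_val, zero_smul, add_zero, LinearMap.smul_apply,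
      LinearMap.add_apply, LinearMap.id_apply]
  refine ⟨A.toContinuousLinearMap, ?_⟩
  ext v
  by_cases hv : LinearIndependent ℝ v
  · have hv3 : v = ![v 0, v 1, v 2] := by
      ext1 i
      fin_cases i <;> rfl
    have h := derivAction_endo stdBasis hτ φ.toAlternatingMap χ.toAlternatingMap (hv3 ▸ hv)
    rw [fderivCompContinuousLinearMap_id, fderivCompContinuousLinearMap_id]
    rw [← hc, ← hL] at h
    simp only [LinearMap.coe_toContinuousLinearMap, derivAction] at h ⊢
    simp only [hA, apply_sum_first, apply_sum_second, apply_sum_third]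
    simp only [Fin.sum_univ_six, Matrix.cons_val, zero_mul, add_zero]
    linear_combination h / 2
  · have h0 : ∀ a : E6 [⋀^Fin 3]→L[ℝ] ℝ, a v = 0 := fun a =>
      a.toAlternatingMap.map_linearDependent v hv
    rw [h0, h0]

/-- Let T be the derivation action of E, and let S be the sum of the three terms of type ψ(Ex, Ey,
z). Then T²ψ = 3cψ + 2S, while T sends ψ(E·, E·, E·) to cS. Eliminating S solves Tχ = ψ. -/
theorem exists_derivAction_eq {E : E6 →ₗ[ℝ] E6} {c : ℝ} (hc : c ≠ 0) (hE : E ∘ₗ E = c • 1)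
    (ψ : E6 [⋀^Fin 3]→L[ℝ] ℝ) :
    ∃ χ : E6 [⋀^Fin 3]→L[ℝ] ℝ,
      χ.fderivCompContinuousLinearMap (ContinuousLinearMap.id ℝ E6) E.toContinuousLinearMap =
        ψ := by
  obtain ⟨A, rfl⟩ : ∃ A : E6 →L[ℝ] E6, E = A.toLinearMap := ⟨E.toContinuousLinearMap, rfl⟩
  have hA : ∀ x, A (A x) = c • x := fun x => LinearMap.congr_fun hE x
  have hEA : A.toLinearMap.toContinuousLinearMap = A := rfl
  rw [hEA]
  refine ⟨(3 * c ^ 2)⁻¹ • (c • ψ.fderivCompContinuousLinearMap (ContinuousLinearMap.id ℝ E6) A -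
    (2 : ℝ) • ψ.compContinuousLinearMap A), ?_⟩
  ext v
  rw [fderivCompContinuousLinearMap_id]
  have hcomp : ∀ x y z, ψ.compContinuousLinearMap A ![x, y, z] =
      ψ.toAlternatingMap ![A x, A y, A z] := fun x y z => by
    rw [ContinuousAlternatingMap.compContinuousLinearMap_apply]
    refine congrArg ψ ?_
    ext1 j
    fin_cases j <;> rfl
  have hχ : ∀ x y z, ((3 * c ^ 2)⁻¹ •
      (c • ψ.fderivCompContinuousLinearMap (ContinuousLinearMap.id ℝ E6) A -
      (2 : ℝ) • ψ.compContinuousLinearMap A)).toAlternatingMap ![x, y, z] =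
      (3 * c ^ 2)⁻¹ * (c * derivAction ψ.toAlternatingMap A.toLinearMap x y z -
        2 * ψ.toAlternatingMap ![A x, A y, A z]) := fun x y z => by
    rw [← hcomp]
    have := fderivCompContinuousLinearMap_id ψ A ![x, y, z]
    simp only [Matrix.cons_val] at this
    rw [← this]
    rfl
  have hv : ψ v = ψ.toAlternatingMap ![v 0, v 1, v 2] := apply_vec_three ψ.toAlternatingMap v
  rw [derivAction, hχ, hχ, hχ, hv]
  simp only [derivAction, ContinuousLinearMap.coe_coe, hA, apply_smul_first, apply_smul_second,
    apply_smul_third]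
  field_simp
  ring

theorem surjective_fderiv {τ : E6 [⋀^Fin 6]→ₗ[ℝ] ℝ} (hτ : τ ≠ 0) {φ : E6 [⋀^Fin 3]→L[ℝ] ℝ}
    {c : ℝ} (hc : c ≠ 0) (h : endo stdBasis τ φ.toAlternatingMap φ.toAlternatingMap ∘ₗ
      endo stdBasis τ φ.toAlternatingMap φ.toAlternatingMap = c • 1) :
    Function.Surjective (φ.fderivCompContinuousLinearMap (ContinuousLinearMap.id ℝ E6)) := by
  intro ψ
  obtain ⟨χ, hχ⟩ := exists_derivAction_eq hc h ψ
  obtain ⟨A, hA⟩ := exists_fderiv_eq_derivAction hτ φ χ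
  exact ⟨A, hA.trans hχ⟩

/-- Q ≠ 0 makes the scalar K² nonzero, so the orbit map is a submersion at the identity, hence at
every g, and its image is open. -/
theorem isStable_of_Q_ne_zero {ω : E6 [⋀^Fin 2]→L[ℝ] ℝ} {φ : E6 [⋀^Fin 3]→L[ℝ] ℝ}
    (hω : liouville ω.toAlternatingMap ≠ 0)
    (hQ : Q stdBasis ω.toAlternatingMap φ.toAlternatingMap ≠ 0) : IsStable φ := by
  obtain ⟨c, hcK⟩ := exists_endo_sq_eq_smul stdBasis hω φ.toAlternatingMap
  have hc : c ≠ 0 := by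
    rintro rfl
    apply hQ
    rw [Q_eq_trace, K_eq_endo, hcK]
    simp
  have hsurj : ∀ ψ : E6 [⋀^Fin 3]→L[ℝ] ℝ, ∃ A : E6 →L[ℝ] E6,
      φ.fderivCompContinuousLinearMap (ContinuousLinearMap.id ℝ E6) A = ψ := 
    surjective_fderiv hω hc hcK
  rw [IsStable, isOpen_iff_mem_nhds]
  rintro _ ⟨g, rfl⟩
  have hder : HasStrictFDerivAt (fun A : E6 →L[ℝ] E6 => φ.compContinuousLinearMap A)
      (φ.fderivCompContinuousLinearMap (g : E6 →L[ℝ] E6)) (g : E6 →L[ℝ] E6) := by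
    have := (hasStrictFDerivAt_const φ (g : E6 →L[ℝ] E6)
      (𝕜 := ℝ)).continuousAlternatingMapCompContinuousLinearMap
        (hasStrictFDerivAt_id (𝕜 := ℝ) (g : E6 →L[ℝ] E6))
    simpa using this
  -- The derivative at g in the direction A ∘ g is the pullback by g of the derivative at the
  -- identity in the direction A.
  have hrange : (φ.fderivCompContinuousLinearMap (g : E6 →L[ℝ] E6)).range = ⊤ := by
    rw [LinearMap.range_eq_top]
    intro ψ
    obtain ⟨A, hA⟩ := hsurj (ψ.compContinuousLinearMap (g.symm : E6 →L[ℝ] E6))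
    refine ⟨A.comp (g : E6 →L[ℝ] E6), ?_⟩
    ext v
    have h1 := congrArg (fun a => a fun i => g (v i)) hA
    simp only [ContinuousAlternatingMap.compContinuousLinearMap_apply] at h1
    have h2 : (⇑(g.symm : E6 →L[ℝ] E6) ∘ fun i => g (v i)) = v := by
      ext1 i
      exact g.symm_apply_apply _
    rw [h2] at h1
    rw [← h1, ContinuousLinearMap.coe_coe,
      ContinuousAlternatingMap.fderivCompContinuousLinearMap_apply,
      ContinuousAlternatingMap.fderivCompContinuousLinearMap_apply]
    refine Finset.sum_congr rfl fun i _ => congrArg φ ?_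
    ext1 j
    by_cases hij : j = i
    · subst hij
      simp
    · simp [hij]
  have hnhds := hder.map_nhds_eq_of_surj hrange
  rw [← hnhds, Filter.mem_map]
  -- Invertible maps form a neighbourhood of g among all endomorphisms.
  refine Filter.mem_of_superset g.nhds ?_
  rintro _ ⟨g', rfl⟩
  exact ⟨g', rfl⟩

end Stable

/-! ### Stability implies nonzero Q -/

section Unstable

/-- The trace of the square of the matrix of `K`, a quartic form in the components of a 3-form. -/
def quartic (f : Fin 6 → Fin 6 → Fin 6 → ℝ) : ℝ := ∑ i, ∑ j, polarK f f i j * polarK f f j i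

theorem Q_eq_zero_iff_quartic {ω : E6 [⋀^Fin 2]→L[ℝ] ℝ} (φ : E6 [⋀^Fin 3]→L[ℝ] ℝ)
    (hω : liouville ω.toAlternatingMap ≠ 0) :
    Q stdBasis ω.toAlternatingMap φ.toAlternatingMap = 0 ↔
      quartic (comp stdBasis φ.toAlternatingMap) = 0 := by
  have h := apply_basis_ne_zero stdBasis _ hω
  rw [Q_eq_trace, K_eq_endo, trace_endo_sq, ← quartic, mul_eq_zero, mul_eq_zero]
  exact ⟨fun hq => (hq.resolve_left (by norm_num)).resolve_left (pow_ne_zero 2 (inv_ne_zero h)),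
    fun hq => Or.inr (Or.inr hq)⟩

theorem polarK_add_smul (f h : Fin 6 → Fin 6 → Fin 6 → ℝ) (t : ℝ) (i j : Fin 6) :
    polarK (fun a b c => f a b c + t * h a b c) (fun a b c => f a b c + t * h a b c) i j =
      polarK f f i j + t * (polarK f h i j + polarK h f i j) + t ^ 2 * polarK h h i j := by
  fin_cases i <;> simp only [polarK, wedgeComp, Matrix.cons_val, Fin.isValue, Fin.reduceFinMk,
    Fin.mk_one, Fin.zero_eta] <;> ring

/-- Along a line the quartic is a polynomial of degree at most 4 in the parameter, with coefficient
`quartic h` in degree 4; the fourth difference isolates it. -/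
theorem quartic_fourth_difference (f h : Fin 6 → Fin 6 → Fin 6 → ℝ) (d : ℝ) :
    quartic (fun a b c => f a b c + 2 * d * h a b c) -
      4 * quartic (fun a b c => f a b c + d * h a b c) + 6 * quartic f -
      4 * quartic (fun a b c => f a b c + -d * h a b c) +
      quartic (fun a b c => f a b c + -(2 * d) * h a b c) = 24 * d ^ 4 * quartic h := by
  simp only [quartic, polarK_add_smul]
  simp only [Finset.mul_sum, ← Finset.sum_sub_distrib, ← Finset.sum_add_distrib]
  refine Finset.sum_congr rfl fun i _ => Finset.sum_congr rfl fun j _ => ?_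
  ring

/-- The 3-form `e⁰ ∧ e¹ ∧ e² + e³ ∧ e⁴ ∧ e⁵` on `ℝ⁶`. -/
noncomputable def splitForm : E6 [⋀^Fin 3]→L[ℝ] ℝ where
  toFun v := Matrix.det (Matrix.of fun i j : Fin 3 => v i (Fin.castAdd 3 j)) +
    Matrix.det (Matrix.of fun i j : Fin 3 => v i (Fin.natAdd 3 j))
  map_update_add' := by
    intro inst v i x y
    obtain rfl : inst = instDecidableEqFin 3 := Subsingleton.elim _ _
    fin_cases i <;> simp [Matrix.det_fin_three, Function.update_apply] <;> ring
  map_update_smul' := by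
    intro inst v i c x
    obtain rfl : inst = instDecidableEqFin 3 := Subsingleton.elim _ _
    fin_cases i <;> simp [Matrix.det_fin_three, Function.update_apply] <;> ring
  map_eq_zero_of_eq' v i j h hij := by
    rw [Matrix.det_zero_of_row_eq hij, Matrix.det_zero_of_row_eq hij, add_zero] <;>
    · ext1 k
      simp [h]
  cont := by
    simp only [Matrix.det_fin_three, Matrix.of_apply]
    fun_prop

theorem splitForm_apply (v : Fin 3 → E6) : splitForm v =
    Matrix.det (Matrix.of fun i j : Fin 3 => v i (Fin.castAdd 3 j)) +
    Matrix.det (Matrix.of fun i j : Fin 3 => v i (Fin.natAdd 3 j)) := rfl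

/-- For this form K is -1 on the first three basis vectors and +1 on the last three, so tr K² = 6.
Only its being nonzero matters. -/
theorem quartic_splitForm : quartic (comp stdBasis splitForm.toAlternatingMap) = 6 := by
  set h := comp stdBasis splitForm.toAlternatingMap with hh
  have hb : ∀ i a : Fin 6, stdBasis i a = if a = i then (1 : ℝ) else 0 := fun i a => by simp
  have hd : ∀ i j k, h i j k =
      Matrix.det (Matrix.of fun a b : Fin 3 =>
        if Fin.castAdd 3 b = (![i, j, k] : Fin 3 → Fin 6) a then (1 : ℝ) else 0) +
      Matrix.det (Matrix.of fun a b : Fin 3 =>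
        if Fin.natAdd 3 b = (![i, j, k] : Fin 3 → Fin 6) a then (1 : ℝ) else 0) := by
    intro i j k
    refine (splitForm_apply _).trans ?_
    congr 2 <;>
    · ext a b
      rw [Matrix.of_apply, Matrix.of_apply]
      fin_cases a <;> exact hb _ _
  have hf : IsAlt h := isAlt_comp _ _
  have hv : ∀ i j k, i < j → j < k → h i j k =
      if (i = 0 ∧ j = 1 ∧ k = 2) ∨ (i = 3 ∧ j = 4 ∧ k = 5) then 1 else 0 := by
    intro i j k hij hjk
    rw [hd, Matrix.det_fin_three, Matrix.det_fin_three]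
    fin_cases i <;> fin_cases j <;> first
      | exact absurd hij (by decide)
      | fin_cases k <;> first
        | exact absurd hjk (by decide)
        | simp [Fin.ext_iff]
  simp only [quartic, Fin.sum_univ_six, polarK, wedgeComp, Matrix.cons_val, Fin.isValue,
    hf.diag_left, zero_mul, add_zero, sub_zero, zero_sub]
  simp only [hf.sort_left, hf.sort_right, Fin.reduceLT, Fin.isValue,
    hf.diag_left, hf.diag_right, zero_mul, add_zero, sub_zero, zero_sub, neg_zero]
  simp only [hv, Fin.reduceLT]
  simp
  norm_num

/-- If Q(φ) = 0, the quartic vanishes on the whole orbit. Were the orbit open, it would vanish near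
φ, in particular on a segment in the direction of `splitForm`, against its nonzero degree-4
coefficient. -/
theorem Q_ne_zero_of_isStable {ω : E6 [⋀^Fin 2]→L[ℝ] ℝ} {φ : E6 [⋀^Fin 3]→L[ℝ] ℝ}
    (hω : liouville ω.toAlternatingMap ≠ 0) (hφ : IsStable φ) :
    Q stdBasis ω.toAlternatingMap φ.toAlternatingMap ≠ 0 := by
  intro hQ
  have horbit : ∀ g : E6 ≃L[ℝ] E6, quartic (comp stdBasis
      (φ.compContinuousLinearMap (g : E6 →L[ℝ] E6)).toAlternatingMap) = 0 := fun g => by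
    rw [← Q_eq_zero_iff_quartic _ (liouville_pullback_ne_zero g ω hω), Q_pullback g ω φ hω, hQ]
  have hmem : φ ∈ Set.range fun g : E6 ≃L[ℝ] E6 =>
      φ.compContinuousLinearMap (g : E6 →L[ℝ] E6) := ⟨ContinuousLinearEquiv.refl ℝ E6, by
    ext v
    rfl⟩
  have hline : Filter.Tendsto (fun t : ℝ => φ + t • splitForm) (nhds 0) (nhds φ) := by
    have : Continuous fun t : ℝ => φ + t • splitForm := by fun_prop
    simpa using this.tendsto 0
  obtain ⟨r, hr, hball⟩ := Metric.mem_nhds_iff.mp (hline (hφ.mem_nhds hmem))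
  have hzero : ∀ t : ℝ, |t| < r → quartic (fun i j k => comp stdBasis φ.toAlternatingMap i j k +
      t * comp stdBasis splitForm.toAlternatingMap i j k) = 0 := fun t ht => by
    obtain ⟨g, hg⟩ := hball (show t ∈ Metric.ball 0 r by simpa using ht)
    have h := horbit g
    simp only at hg
    rw [hg] at h
    exact h
  -- The step r/3 keeps the five parameters 0, ±r/3, ±2r/3 within the radius r.
  have h := quartic_fourth_difference (comp stdBasis φ.toAlternatingMap)
    (comp stdBasis splitForm.toAlternatingMap) (r / 3)
  have h0 := hzero 0 (by simpa using hr)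
  simp only [zero_mul, add_zero] at h0
  rw [hzero, hzero, hzero, hzero, quartic_splitForm, h0] at h
  · have : 0 < r ^ 4 := by positivity
    nlinarith
  all_goals
    rw [abs_lt]
    constructor <;> linarith

theorem isStable_iff_Q_ne_zero {ω : E6 [⋀^Fin 2]→L[ℝ] ℝ} {φ : E6 [⋀^Fin 3]→L[ℝ] ℝ}
    (hω : liouville ω.toAlternatingMap ≠ 0) :
    IsStable φ ↔ Q stdBasis ω.toAlternatingMap φ.toAlternatingMap ≠ 0 :=
  ⟨Q_ne_zero_of_isStable hω, isStable_of_Q_ne_zero hω⟩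

end Unstable

end ThreeForm

theorem mainTheorem1 {M : Type*} [TopologicalSpace M] [T2Space M] [SecondCountableTopology M]
    [ConnectedSpace M] [ChartedSpace ThreeForm.E6 M]
    [IsManifold (𝓡 6) ((⊤ : ℕ∞) : WithTop ℕ∞) M]
    (ω : ThreeForm.DiffForm M 2) (hω : ThreeForm.IsSymplectic ω)
    (φ : ThreeForm.DiffForm M 3) (hφ : ThreeForm.IsSmoothForm φ)
    (hprim : ThreeForm.IsPrimitive ω φ)
    (hd : ThreeForm.IsIntegrable φ) (hF : ThreeForm.IsFIntegrable ω φ) :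
    ThreeForm.IsKIntegrable ω φ ∧ ThreeForm.IsQIntegrable ω φ ∧
      ((∀ x, ThreeForm.IsStableAt φ x) ∨ (∀ x, ¬ ThreeForm.IsStableAt φ x)) := by
  have hst : ∀ x, ThreeForm.IsStableAt φ x ↔ ThreeForm.functionQ ω φ x ≠ 0 := fun x =>
    ThreeForm.isStable_iff_Q_ne_zero (hω.liouville_ne_zero x)
  obtain ⟨c, hc⟩ := ThreeForm.isQIntegrable hω hφ hd hF
  refine ⟨ThreeForm.isKIntegrable hω hφ hd hF, ⟨c, hc⟩, ?_⟩
  simp only [hst, hc]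
  by_cases h : c = 0
  · exact Or.inr fun _ => not_not.mpr h
  · exact Or.inl fun _ => h
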